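/- Let $p \geq 1$ be an integer and let $k$ be a field. Let $\Lambda_p$ be the $p$-cyclic category: its objects $[n]$ are numbered by integers $n \geq 1$; let $\Lambda_\infty([n],[m])$ be the set of all non-decreasing maps $f:\mathbb{Z}\to\mathbb{Z}$ such that $f(a+n)=f(a)+m$ for all $a$; then $\Lambda_p([n],[m]) = \Lambda_\infty([n],[m])/\sigma^p$, the set of orbits of the group generated by $f \mapsto \sigma^p\circ f$, where $\sigma:[m]\to[m]$ is the map $\sigma(a)=a+m$. Let $\mathrm{Fun}(\Lambda_p,k)$ be the category of functors from $\Lambda_p$ to $k$-vector spaces, and let $H_i(\Lambda_p,-)$, $i \geq 0$, be the $i$-th left derived functor of the direct limit functor $\varinjlim_{\Lambda_p}:\mathrm{Fun}(\Lambda_p,k)\to k\text{-}\mathrm{Vect}$. For $n \geq 1$ and $0 \leq i \leq n$, let $m_i \in \Lambda_p([n+1],[n])$ be the class of the map given, for $a \in \mathbb{Z}$ and $0 \leq b \leq n$, by $f(a(n+1)+b) = an+b$ if $b \leq i$ and $f(a(n+1)+b)=an+b-1$ if $b>i$. For $E \in \mathrm{Fun}(\Lambda_p,k)$, let $\tau:E([n])\to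 E([n])$ be $(-1)^{n-1}$ times the map induced by $a \mapsto a+1$, and let $$b_p=\sum_{i=0}^{n}(-1)^i E(m_i),\qquad b'_p=\sum_{i=0}^{n-1}(-1)^iE(m_i)\;:\;E([n+1])\to E([n]).$$ One has $b_p^2=0$, $(b'_p)^2=0$, $\tau^{pn}=\mathrm{id}$ on $E([n])$, $(\mathrm{id}-\tau)\,b'_p=b_p\,(\mathrm{id}-\tau)$ and $(\mathrm{id}+\tau+\dots+\tau^{pn-1})\,b_p=b'_p\,(\mathrm{id}+\tau+\dots+\tau^{p(n+1)-1})$ as maps $E([n+1])\to E([n])$. Hence there is a bicomplex $C_{\bullet,\bullet}(E)$ (with commuting squares) with terms $C_{i,j}(E)=E([j+1])$, $i,j\geq 0$; with vertical differential $C_{i,j+1}(E)\to C_{i,j}(E)$ equal to $b_p$ for $i$ even and to $b'_p$ for $i$ odd; and with horizontal differential $C_{i+1,j}(E)\to C_{i,j}(E)$ equal to $\mathrm{id}-\tau$ for $i$ even and to $\mathrm{id}+\tau+\dots+\tau^{p(j+1)-1}$ for $i$ odd. Let $\mathrm{Tot}_\bullet(E)$ be its total complex, $\mathrm{Tot}_n(E)=\bigoplus_{i+j=n}C_{i,j}(E)$,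 with differential the horizontal differential plus $(-1)^i$ times the vertical differential on $C_{i,j}(E)$. Lemma. For every $n\geq 0$ there is an isomorphism $$H_n(\Lambda_p,E)\;\cong\;H_n(\mathrm{Tot}_\bullet(E)),$$ natural in $E \in \mathrm{Fun}(\Lambda_p,k)$. -/

import Mathlib

open CategoryTheory Limits

universe u

/-! ## Homology of small categories -/

section SmallCategoryHomology

variable {k : Type u} [Field k] {Γ : Type} [SmallCategory Γ]

/-- The free functor `k[Γ(c, -)]` is projective in `Fun(Γ, k)`. -/
theorem projective_free_corepresentable (c : Γ) :
    Projective ((uliftCoyoneda.{u}.obj (Opposite.op c) ⋙ ModuleCat.free k :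
      Γ ⥤ ModuleCat.{u} k)) := by
  have hS : Projective (uliftCoyoneda.{u}.obj (Opposite.op c) : Γ ⥤ Type u) := by
    refine ⟨fun {E X} f e _ => ?_⟩
    have he : Function.Surjective (e.app c) := by
      rw [← epi_iff_surjective]
      infer_instance
    obtain ⟨y, hy⟩ := he (uliftCoyonedaEquiv f)
    refine ⟨uliftCoyonedaEquiv.symm y, ?_⟩
    apply uliftCoyonedaEquiv.injective
    rw [uliftCoyonedaEquiv_comp, Equiv.apply_symm_apply]
    exact hy
  have adj := (ModuleCat.adj k).whiskerRight Γ
  have : ((Functor.whiskeringRight Γ _ _).obj (forget (ModuleCat.{u} k))).PreservesEpimorphisms := by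
    refine ⟨fun {X Y} f _ => ?_⟩
    rw [NatTrans.epi_iff_epi_app]
    intro d
    exact inferInstanceAs (Epi ((forget (ModuleCat.{u} k)).map (f.app d)))
  exact adj.map_projective _ hS

/-- `Fun(Γ, k)` has enough projectives. -/
instance enoughProjectives_functor_moduleCat : EnoughProjectives (Γ ⥤ ModuleCat.{u} k) where
  presentation F := by
    let P : (Σ c : Γ, F.obj c) → (Γ ⥤ ModuleCat.{u} k) := fun s =>
      uliftCoyoneda.{u}.obj (Opposite.op s.1) ⋙ ModuleCat.free k
    let adj := (ModuleCat.adj k).whiskerRight Γ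
    let φ : ∀ s, P s ⟶ F := fun s =>
      (adj.homEquiv _ _).symm (uliftCoyonedaEquiv.symm s.2)
    have hP : ∀ s, Projective (P s) := fun s => projective_free_corepresentable s.1
    refine ⟨{ p := ∐ P, f := Limits.Sigma.desc φ, epi := ?_ }⟩
    rw [NatTrans.epi_iff_epi_app]
    intro c
    rw [ModuleCat.epi_iff_surjective]
    intro x
    have hx : ((φ ⟨c, x⟩).app c) (ModuleCat.freeMk (ULift.up (𝟙 c))) = x := by
      have h : uliftCoyonedaEquiv (adj.homEquiv _ _ (φ ⟨c, x⟩)) = x := by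
        simp only [φ, Equiv.apply_symm_apply]
      exact h
    refine ⟨(Sigma.ι P ⟨c, x⟩).app c (ModuleCat.freeMk (ULift.up (𝟙 c))), ?_⟩
    rw [← ConcreteCategory.comp_apply, ← NatTrans.comp_app, Sigma.ι_desc]
    exact hx

/-- The homology functor `H_n(Γ, -) : Fun(Γ, k) ⥤ Vect_k`: the `n`-th left derived functor of the
direct limit functor. -/
noncomputable def smallCategoryHomology (k : Type u) [Field k] (Γ : Type) [SmallCategory Γ]
    (n : ℕ) : (Γ ⥤ ModuleCat.{u} k) ⥤ ModuleCat.{u} k :=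
  (colim : (Γ ⥤ ModuleCat.{u} k) ⥤ ModuleCat.{u} k).leftDerived n

end SmallCategoryHomology

/-! ## The categories `Λ_p` -/

/-- A morphism `[n] ⟶ [m]` of the category `Λ_∞`. -/
@[ext]
structure ParacyclicHom (n m : ℕ) where
  toFun : ℤ → ℤ
  monotone' : Monotone toFun
  map_add_period' : ∀ a, toFun (a + n) = toFun a + m

namespace ParacyclicHom

/-- The identity of `[n]`. -/
def id (n : ℕ) : ParacyclicHom n n := ⟨fun a => a, monotone_id, fun _ => rfl⟩

/-- The composition `g ∘ f`. -/
def comp {n m l : ℕ} (g : ParacyclicHom m l) (f : ParacyclicHom n m) : ParacyclicHom n l :=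
  ⟨fun a => g.toFun (f.toFun a), g.monotone'.comp f.monotone',
    fun a => by rw [f.map_add_period', g.map_add_period']⟩

/-- The power `τ^j` of the rotation `τ : a ↦ a + 1` of `[n]`. -/
def rot (n : ℕ) (j : ℤ) : ParacyclicHom n n :=
  ⟨fun a => a + j, fun _ _ h => by simpa using h, fun a => by ring⟩

/-- The power `σ^j` of the endomorphism `σ : a ↦ a + n` of `[n]`. -/
def sigma (n : ℕ) (j : ℤ) : ParacyclicHom n n :=
  ⟨fun a => a + j * n, fun _ _ h => by simpa using h, fun a => by ring⟩

theorem map_add_mul {n m : ℕ} (f : ParacyclicHom n m) (a j : ℤ) :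
    f.toFun (a + j * n) = f.toFun a + j * m := by
  induction j using Int.induction_on with
  | zero => simp
  | succ i ih =>
    have h := f.map_add_period' (a + i * n)
    rw [ih] at h
    rw [show a + ((i : ℤ) + 1) * n = a + i * n + n by ring, h]
    ring
  | pred i ih =>
    have h := f.map_add_period' (a + (-(i : ℤ) - 1) * n)
    rw [show a + (-(i : ℤ) - 1) * n + n = a + -(i : ℤ) * n by ring, ih] at h
    linarith

/-- The orbit relation of the group generated by `σ^p` on `Λ_∞([n],[m])`. -/
def setoid (p n m : ℕ) : Setoid (ParacyclicHom n m) where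
  r f g := ∃ j : ℤ, g = (sigma m (j * p)).comp f
  iseqv :=
    { refl := fun f => ⟨0, by ext a; simp [comp, sigma]⟩
      symm := by
        rintro f g ⟨j, rfl⟩
        refine ⟨-j, ?_⟩
        ext a
        simp only [comp, sigma]
        ring
      trans := by
        rintro f g h ⟨i, rfl⟩ ⟨j, rfl⟩
        refine ⟨i + j, ?_⟩
        ext a
        simp only [comp, sigma]
        ring }

end ParacyclicHom

/-- The objects `[n]`, `n ≥ 1`, of the category `Λ_p`. -/
@[ext]
structure LambdaCat (p : ℕ) where
  size : ℕ
  size_pos : 1 ≤ size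

namespace LambdaCat

variable {p : ℕ}

/-- `Λ_p([n],[m]) = Λ_∞([n],[m]) / σ^p`. -/
instance category : SmallCategory (LambdaCat p) where
  Hom X Y := Quotient (ParacyclicHom.setoid p X.size Y.size)
  id X := Quotient.mk _ (ParacyclicHom.id X.size)
  comp f g := Quotient.map₂ (fun f g => g.comp f)
    (by
      rintro f _ ⟨i, rfl⟩ g _ ⟨j, rfl⟩
      refine ⟨i + j, ?_⟩
      ext a
      simp only [ParacyclicHom.comp, ParacyclicHom.sigma, ParacyclicHom.map_add_mul]
      ring) f g
  id_comp f := by induction f using Quotient.inductionOn with | h f => rfl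
  comp_id f := by induction f using Quotient.inductionOn with | h f => rfl
  assoc f g h := by
    induction f using Quotient.inductionOn with | h f =>
    induction g using Quotient.inductionOn with | h g =>
    induction h using Quotient.inductionOn with | h h => rfl

/-- The projection `Λ_∞([n],[m]) → Λ_p([n],[m])`. -/
def homMk {X Y : LambdaCat p} (f : ParacyclicHom X.size Y.size) : X ⟶ Y := Quotient.mk _ f

theorem homMk_comp {X Y Z : LambdaCat p} (f : ParacyclicHom X.size Y.size)
    (g : ParacyclicHom Y.size Z.size) :
    homMk f ≫ homMk g = (homMk (g.comp f) : X ⟶ Z) := rfl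

theorem homMk_eq_of {X Y : LambdaCat p} {f g : ParacyclicHom X.size Y.size} (j : ℤ)
    (h : ∀ a, g.toFun a = f.toFun a + j * p * Y.size) : (homMk f : X ⟶ Y) = homMk g :=
  Quotient.sound ⟨j, by ext a; exact h a⟩

/-- The object `[n + 1]`. -/
def ob (p n : ℕ) : LambdaCat p := ⟨n + 1, by lia⟩

/-- The rotation `τ : [n + 1] ⟶ [n + 1]`, `a ↦ a + 1`. -/
def tau (p n : ℕ) : End (ob p n) := homMk (ParacyclicHom.rot (n + 1) 1)

end LambdaCat

/-- The map `m_i : [n + 1] ⟶ [n]` of `Λ_∞`, for `n ≥ 1` and `0 ≤ i ≤ n`: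
`f(a(n+1)+b) = an+b` if `b ≤ i` and `f(a(n+1)+b) = an+b-1` if `b > i`, where `0 ≤ b ≤ n`. -/
def ParacyclicHom.face (n i : ℕ) : ParacyclicHom (n + 1) n where
  toFun x :=
    if x % (n + 1) ≤ i then x / (n + 1) * n + x % (n + 1)
    else x / (n + 1) * n + x % (n + 1) - 1
  monotone' := by
    apply monotone_int_of_le_succ
    intro x
    have h0 : (0 : ℤ) < n + 1 := by positivity
    have h1 := Int.emod_nonneg x h0.ne'
    have h2 := Int.emod_lt_of_pos x h0
    have h3 := Int.emod_add_mul_ediv x (n + 1)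
    generalize x % ((n : ℤ) + 1) = b at *
    generalize x / ((n : ℤ) + 1) = a at *
    subst h3
    by_cases hb : b = n
    · have e1 : (b + (n + 1) * a + 1) % ((n : ℤ) + 1) = 0 := by
        rw [show b + (n + 1) * a + 1 = (n + 1) * (a + 1) by rw [hb]; ring]
        simp
      have e2 : (b + (n + 1) * a + 1) / ((n : ℤ) + 1) = a + 1 := by
        rw [show b + (n + 1) * a + 1 = (n + 1) * (a + 1) by rw [hb]; ring]
        exact Int.mul_ediv_cancel_left _ h0.ne'
      rw [e1, e2, add_mul]
      split_ifs <;> lia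
    · have e1 : (b + (n + 1) * a + 1) % ((n : ℤ) + 1) = b + 1 := by
        rw [show b + (n + 1) * a + 1 = b + 1 + (n + 1) * a by ring, Int.add_mul_emod_self_left]
        exact Int.emod_eq_of_lt (by lia) (by lia)
      have e2 : (b + (n + 1) * a + 1) / ((n : ℤ) + 1) = a := by
        rw [show b + (n + 1) * a + 1 = b + 1 + (n + 1) * a by ring,
          Int.add_mul_ediv_left _ _ h0.ne', Int.ediv_eq_zero_of_lt (by lia) (by lia), zero_add]
      rw [e1, e2]
      split_ifs <;> lia
  map_add_period' x := by
    have h0 : (0 : ℤ) < n + 1 := by positivity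
    have e1 : (x + (n + 1)) % ((n : ℤ) + 1) = x % (n + 1) := by simp
    have e2 : (x + (n + 1)) / ((n : ℤ) + 1) = x / (n + 1) + 1 := by
      rw [Int.add_ediv_of_dvd_right (dvd_refl _), Int.ediv_self h0.ne']
    push_cast
    rw [e1, e2]
    split_ifs <;> ring

theorem ParacyclicHom.face_apply (n i : ℕ) (a b : ℤ) (hb : 0 ≤ b) (hb' : b ≤ n) :
    (ParacyclicHom.face n i).toFun (a * (n + 1) + b) =
      if b ≤ i then a * n + b else a * n + b - 1 := by
  have h0 : (0 : ℤ) < n + 1 := by positivity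
  have e1 : (a * (n + 1) + b) % ((n : ℤ) + 1) = b := by
    rw [add_comm, Int.add_mul_emod_self_right]
    exact Int.emod_eq_of_lt hb (by lia)
  have e2 : (a * (n + 1) + b) / ((n : ℤ) + 1) = a := by
    rw [add_comm, Int.add_mul_ediv_right _ _ h0.ne', Int.ediv_eq_zero_of_lt hb (by lia), zero_add]
  simp only [ParacyclicHom.face, e1, e2]

namespace LambdaCat

variable {p : ℕ}

/-- The map `m_i : [n + 2] ⟶ [n + 1]`, for `0 ≤ i ≤ n + 1`. -/
def face (p n i : ℕ) : ob p (n + 1) ⟶ ob p n := homMk (ParacyclicHom.face (n + 1) i)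

/-- To compare two maps out of `[n + 1]`, it suffices to compare them on one period. -/
theorem hom_ext_period {n m : ℕ} (f g : ParacyclicHom (n + 1) m)
    (h : ∀ b : ℤ, 0 ≤ b → b ≤ n → f.toFun b = g.toFun b) : f = g := by
  ext x
  have h0 : (0 : ℤ) < n + 1 := by positivity
  have h1 := Int.emod_nonneg x h0.ne'
  have h2 := Int.emod_lt_of_pos x h0
  have h3 : x = x % (n + 1) + x / (n + 1) * (n + 1 : ℕ) := by
    push_cast
    exact (Int.emod_add_ediv_mul x (n + 1)).symm
  rw [h3, f.map_add_mul, g.map_add_mul, h _ h1 (by lia)]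

theorem face_apply_zero (n i : ℕ) (hi : i ≤ n) (b : ℤ) (hb : 0 ≤ b) (hb' : b ≤ n + 1) :
    (ParacyclicHom.face n i).toFun b = if b ≤ i then b else b - 1 := by
  by_cases h : b ≤ n
  · simpa using ParacyclicHom.face_apply n i 0 b hb h
  · have e := ParacyclicHom.face_apply n i 1 0 le_rfl (by positivity)
    obtain rfl : b = n + 1 := by lia
    rw [show (1 : ℤ) * (n + 1) + 0 = n + 1 by ring] at e
    rw [e]
    split_ifs <;> lia

theorem face_comp_face (n i j : ℕ) (hij : i ≤ j) (hj : j ≤ n + 1) :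
    face p (n + 1) (j + 1) ≫ face p n i = face p (n + 1) i ≫ face p n j := by
  refine congrArg homMk ?_
  refine hom_ext_period _ _ fun b hb hb' => ?_
  simp only [ParacyclicHom.comp]
  push_cast at hb'
  rw [face_apply_zero _ _ (by lia) b hb (by push_cast; lia),
    face_apply_zero _ _ (by lia) b hb (by push_cast; lia)]
  split_ifs <;> (try rw [face_apply_zero _ _ (by lia) _ (by lia) (by push_cast; lia)]) <;>
    (try rw [face_apply_zero _ _ (by lia) _ (by lia) (by push_cast; lia)]) <;> split_ifs <;> lia

theorem tau_comp_face_succ (n i : ℕ) (hi : i ≤ n) :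
    tau p (n + 1) ≫ face p n (i + 1) = face p n i ≫ tau p n := by
  refine congrArg homMk ?_
  refine hom_ext_period _ _ fun b hb hb' => ?_
  simp only [ParacyclicHom.comp, ParacyclicHom.rot]
  push_cast at hb'
  rw [face_apply_zero _ _ (by lia) _ (by lia) (by push_cast; lia),
    face_apply_zero _ _ (by lia) _ (by lia) (by push_cast; lia)]
  split_ifs <;> lia

theorem tau_comp_face_zero (n : ℕ) :
    tau p (n + 1) ≫ face p n 0 = face p n (n + 1) := by
  refine congrArg homMk ?_
  refine hom_ext_period _ _ fun b hb hb' => ?_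
  simp only [ParacyclicHom.comp, ParacyclicHom.rot]
  push_cast at hb'
  rw [face_apply_zero _ _ (by lia) _ (by lia) (by push_cast; lia),
    face_apply_zero _ _ (by lia) _ (by lia) (by push_cast; lia)]
  split_ifs <;> lia

theorem tau_pow (n j : ℕ) :
    tau p n ^ j = (homMk (ParacyclicHom.rot (n + 1) j) : ob p n ⟶ ob p n) := by
  induction j with
  | zero =>
    refine congrArg homMk ?_
    ext a
    simp [ParacyclicHom.rot, ParacyclicHom.id]
  | succ j ih =>
    rw [pow_succ, ih]
    refine congrArg homMk ?_
    ext a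
    simp [ParacyclicHom.rot, ParacyclicHom.comp]
    ring

theorem tau_pow_mul (n : ℕ) : tau p n ^ (p * (n + 1)) = 1 := by
  rw [tau_pow]
  refine homMk_eq_of (-1) fun a => ?_
  simp [ParacyclicHom.rot, ParacyclicHom.id, ob]

end LambdaCat

/-! ## The bicomplex of a `p`-cyclic object -/

section Algebra

variable {C : Type*} [Category* C]

theorem pow_comp_aux {X Y : C} (T : End X) (T' : End Y) (D : ℕ → (X ⟶ Y)) (m : ℕ)
    (h : ∀ l < m, T ≫ D (l + 1) = D l ≫ T') (j l : ℕ) (hl : j + l ≤ m) :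
    (T ^ j : End X) ≫ D (l + j) = D l ≫ (T' ^ j : End Y) := by
  induction j with
  | zero => simp [End.one_def]
  | succ j ih =>
    rw [pow_succ', pow_succ, End.mul_def, End.mul_def, Category.assoc, ← add_assoc, h _ (by lia)]
    rw [← Category.assoc, ih (by lia), Category.assoc, ← End.mul_def, ← End.mul_def, ← pow_succ,
      ← pow_succ']

theorem sigma_comp_aux {X Y : C} (T : End X) (T' : End Y) (D : ℕ → (X ⟶ Y)) (m : ℕ)
    (h : ∀ l < m, T ≫ D (l + 1) = D l ≫ T') (h0 : T ≫ D 0 = D m) (l : ℕ) (hl : l ≤ m) :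
    (T ^ (m + 1) : End X) ≫ D l = D l ≫ (T' ^ m : End Y) := by
  have e1 := pow_comp_aux T T' D m h l 0 (by lia)
  have e2 := pow_comp_aux T T' D m h (m - l) l (by lia)
  rw [zero_add] at e1
  rw [Nat.add_sub_cancel' hl] at e2
  have hX : (T ^ (m + 1) : X ⟶ X) = (T ^ (m - l) : X ⟶ X) ≫ T ≫ (T ^ l : X ⟶ X) := by
    rw [← End.mul_def, ← End.mul_def, ← pow_succ, ← pow_add]
    congr 1
    lia
  have hY : (T' ^ m : Y ⟶ Y) = (T' ^ (m - l) : Y ⟶ Y) ≫ (T' ^ l : Y ⟶ Y) := by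
    rw [← End.mul_def, ← pow_add]
    congr 1
    lia
  rw [hX, hY, Category.assoc, Category.assoc, e1, reassoc_of% h0, reassoc_of% e2]

theorem sigma_pow_comp_aux {X Y : C} (T : End X) (T' : End Y) (D : ℕ → (X ⟶ Y)) (m p : ℕ)
    (h : ∀ l < m, T ≫ D (l + 1) = D l ≫ T') (h0 : T ≫ D 0 = D m) (l : ℕ) (hl : l ≤ m) :
    (T ^ (p * (m + 1)) : End X) ≫ D l = D l ≫ (T' ^ (p * m) : End Y) := by
  induction p with
  | zero => simp [End.one_def]
  | succ p ih =>
    have hS : ∀ {Z : C} (S : End Z) (a : ℕ),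
        (S ^ ((p + 1) * a) : Z ⟶ Z) = (S ^ (p * a) : Z ⟶ Z) ≫ (S ^ a : Z ⟶ Z) := fun S a => by
      rw [← End.mul_def, ← pow_add]
      congr 1
      ring
    rw [hS, hS, Category.assoc, sigma_comp_aux T T' D m h h0 l hl, reassoc_of% ih]

variable [Preadditive C]

theorem alternating_comp_alternating {X Y Z : C} (f : ℕ → (X ⟶ Y)) (g : ℕ → (Y ⟶ Z)) (m : ℕ)
    (h : ∀ i j, i ≤ j → j < m → f (j + 1) ≫ g i = f i ≫ g j) :
    (∑ i ∈ Finset.range (m + 1), (-1 : ℤ) ^ i • f i) ≫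
      (∑ i ∈ Finset.range m, (-1 : ℤ) ^ i • g i) = 0 := by
  induction m with
  | zero => simp
  | succ m ih =>
    rw [Finset.sum_range_succ _ (m + 1), Preadditive.add_comp, Finset.sum_range_succ (n := m)
      (f := fun i => (-1 : ℤ) ^ i • g i), Preadditive.comp_add,
      ih fun i j hij hj => h i j hij (by lia), zero_add,
      ← Finset.sum_range_succ (fun i => (-1 : ℤ) ^ i • g i)]
    simp only [Preadditive.comp_sum, Preadditive.sum_comp, Preadditive.zsmul_comp,
      Preadditive.comp_zsmul, Finset.smul_sum]
    rw [← Finset.sum_add_distrib]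
    refine Finset.sum_eq_zero fun i hi => ?_
    rw [Finset.mem_range] at hi
    rw [h i m (by lia) (by lia)]
    simp only [smul_smul, ← add_smul]
    rw [show ((-1 : ℤ) ^ m * (-1) ^ i + (-1) ^ i * (-1) ^ (m + 1)) = 0 by ring, zero_smul]

/-- The abstract form of `b (1 - τ) = (1 - τ) b'`. -/
theorem one_sub_comp_aux {X Y : C} (T : X ⟶ X) (T' : Y ⟶ Y) (D : ℕ → (X ⟶ Y)) (m : ℕ)
    (h : ∀ l < m, T ≫ D (l + 1) = D l ≫ T') (h0 : T ≫ D 0 = D m) :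
    (𝟙 X - T) ≫ (∑ l ∈ Finset.range (m + 1), D l) =
      (∑ l ∈ Finset.range m, D l) ≫ (𝟙 Y - T') := by
  have e : T ≫ (∑ l ∈ Finset.range (m + 1), D l) = (∑ l ∈ Finset.range m, D l) ≫ T' + D m := by
    rw [Finset.sum_range_succ', Preadditive.comp_add, h0, Preadditive.comp_sum,
      Preadditive.sum_comp]
    congr 1
    exact Finset.sum_congr rfl fun l hl => h l (Finset.mem_range.1 hl)
  rw [Preadditive.sub_comp, e, Preadditive.comp_sub, Finset.sum_range_succ, Category.id_comp,
    Category.comp_id]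
  abel

/-- The abstract form of `b' (1 + ⋯ + τ^m) = (1 + ⋯ + τ^(m-1)) b`. -/
theorem norm_comp_aux_one {X Y : C} (T : End X) (T' : End Y) (D : ℕ → (X ⟶ Y)) (m : ℕ)
    (h : ∀ l < m, T ≫ D (l + 1) = D l ≫ T') (h0 : T ≫ D 0 = D m) :
    (∑ j ∈ Finset.range (m + 1), (T ^ j : X ⟶ X)) ≫ (∑ l ∈ Finset.range m, D l) =
      (∑ l ∈ Finset.range (m + 1), D l) ≫ (∑ j ∈ Finset.range m, (T' ^ j : Y ⟶ Y)) := by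
  have key : ∀ r ≤ m, T ≫ (∑ l ∈ Finset.range (r + 1), D l) =
      (∑ l ∈ Finset.range r, D l) ≫ T' + D m := fun r hr => by
    rw [Finset.sum_range_succ', Preadditive.comp_add, h0, Preadditive.comp_sum,
      Preadditive.sum_comp]
    congr 1
    exact Finset.sum_congr rfl fun l hl => h l (by have := Finset.mem_range.1 hl; lia)
  have hT : ∀ {Z : C} (S : End Z) (e : ℕ), (∑ j ∈ Finset.range (e + 1), (S ^ j : Z ⟶ Z)) =
      S ≫ (∑ j ∈ Finset.range e, (S ^ j : Z ⟶ Z)) + 𝟙 Z := fun S e => by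
    rw [Finset.sum_range_succ', pow_zero, Preadditive.comp_sum]
    rfl
  have claim : ∀ e ≤ m, (∑ j ∈ Finset.range (e + 1), (T ^ j : X ⟶ X)) ≫
      (∑ l ∈ Finset.range m, D l) =
      (∑ l ∈ Finset.range (m - e), D l) ≫ (T' ^ e : Y ⟶ Y) +
        (∑ l ∈ Finset.range (m + 1), D l) ≫ (∑ j ∈ Finset.range e, (T' ^ j : Y ⟶ Y)) := by
    intro e
    induction e with
    | zero => intro _; simp [End.one_def]
    | succ e ih =>
      intro he
      obtain ⟨r, rfl⟩ : ∃ r, m = r + (e + 1) := ⟨m - (e + 1), by lia⟩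
      have hp : T' ≫ (T' ^ e : Y ⟶ Y) = (T' ^ (e + 1) : Y ⟶ Y) := (pow_succ T' e).symm
      rw [hT T (e + 1), Preadditive.add_comp, Category.assoc, ih (by lia), Preadditive.comp_add,
        ← Category.assoc, ← Category.assoc, show r + (e + 1) - e = r + 1 by lia,
        key r (by lia), key _ le_rfl, Category.id_comp, hT T' e, Preadditive.add_comp,
        Category.assoc, hp, show r + (e + 1) - (e + 1) = r by lia]
      have h2 : T' ≫ (∑ j ∈ Finset.range e, (T' ^ j : Y ⟶ Y)) + 𝟙 Y =
          (∑ j ∈ Finset.range e, (T' ^ j : Y ⟶ Y)) + (T' ^ e : Y ⟶ Y) := by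
        rw [← hT, Finset.sum_range_succ]
      rw [Finset.sum_range_succ D, Preadditive.add_comp (f := ∑ l ∈ Finset.range _, D l) (f' := D _)
        (g := T' ≫ _ + 𝟙 Y)]
      have h3 : D (r + (e + 1)) ≫ (T' ≫ (∑ j ∈ Finset.range e, (T' ^ j : Y ⟶ Y)) + 𝟙 Y) =
          D (r + (e + 1)) ≫ (∑ j ∈ Finset.range e, (T' ^ j : Y ⟶ Y)) +
            D (r + (e + 1)) ≫ (T' ^ e : Y ⟶ Y) := by
        rw [h2]
        exact Preadditive.comp_add ..
      rw [h3]
      simp only [Preadditive.add_comp, Preadditive.comp_add, Category.assoc, Category.comp_id]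
      abel
  have := claim m le_rfl
  simpa using this

theorem norm_comp_aux {X Y : C} (T : End X) (T' : End Y) (D : ℕ → (X ⟶ Y)) (m p : ℕ)
    (h : ∀ l < m, T ≫ D (l + 1) = D l ≫ T') (h0 : T ≫ D 0 = D m) :
    (∑ j ∈ Finset.range (p * (m + 1)), (T ^ j : X ⟶ X)) ≫ (∑ l ∈ Finset.range m, D l) =
      (∑ l ∈ Finset.range (m + 1), D l) ≫ (∑ j ∈ Finset.range (p * m), (T' ^ j : Y ⟶ Y)) := by
  induction p with
  | zero => simp
  | succ p ih =>
    have hsplit : ∀ {Z : C} (S : End Z) (a b : ℕ),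
        (∑ j ∈ Finset.range (a + b), (S ^ j : Z ⟶ Z)) =
          HAdd.hAdd (α := Z ⟶ Z) (∑ j ∈ Finset.range a, (S ^ j : Z ⟶ Z))
            ((S ^ a : Z ⟶ Z) ≫ (∑ j ∈ Finset.range b, (S ^ j : Z ⟶ Z))) := fun S a b => by
      rw [Finset.sum_range_add, Preadditive.comp_sum]
      congr 1
      refine Finset.sum_congr rfl fun i _ => ?_
      rw [add_comm, pow_add]
      rfl
    have hσ : (T ^ (p * (m + 1)) : X ⟶ X) ≫ (∑ l ∈ Finset.range (m + 1), D l) =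
        (∑ l ∈ Finset.range (m + 1), D l) ≫ (T' ^ (p * m) : Y ⟶ Y) := by
      rw [Preadditive.comp_sum, Preadditive.sum_comp]
      exact Finset.sum_congr rfl fun l hl =>
        sigma_pow_comp_aux T T' D m p h h0 l (by have := Finset.mem_range.1 hl; lia)
    rw [add_mul p 1 (m + 1), add_mul p 1 m, one_mul, one_mul, hsplit T _ (m + 1), hsplit T' _ m,
      Preadditive.add_comp, ih,
      Category.assoc, norm_comp_aux_one T T' D m h h0, ← Category.assoc, hσ,
      Preadditive.comp_add, Category.assoc]

end Algebra

namespace PCyclic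

variable {p : ℕ} {C : Type*} [Category* C] [Preadditive C]

section

variable (E : LambdaCat p ⥤ C)

/-- The differential `b' = ∑_{0 ≤ i ≤ n} (-1)^i m_i : E([n + 2]) ⟶ E([n + 1])`. -/
def b' (n : ℕ) : E.obj (LambdaCat.ob p (n + 1)) ⟶ E.obj (LambdaCat.ob p n) :=
  ∑ i ∈ Finset.range (n + 1), (-1 : ℤ) ^ i • E.map (LambdaCat.face p n i)

/-- The differential `b = ∑_{0 ≤ i ≤ n + 1} (-1)^i m_i : E([n + 2]) ⟶ E([n + 1])`. -/
def b (n : ℕ) : E.obj (LambdaCat.ob p (n + 1)) ⟶ E.obj (LambdaCat.ob p n) :=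
  ∑ i ∈ Finset.range (n + 2), (-1 : ℤ) ^ i • E.map (LambdaCat.face p n i)

/-- The action of `τ` on `E([n + 1])`, twisted by the sign `(-1)^n`. -/
def t (n : ℕ) : End (E.obj (LambdaCat.ob p n)) :=
  ((-1 : ℤ) ^ n • E.map (LambdaCat.tau p n) :
    E.obj (LambdaCat.ob p n) ⟶ E.obj (LambdaCat.ob p n))

/-- `id - τ` on `E([n + 1])`. -/
def oneSubT (n : ℕ) : End (E.obj (LambdaCat.ob p n)) :=
  1 - t E n

/-- `id + τ + ⋯ + τ^(p(n + 1) - 1)` on `E([n + 1])`. -/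
def norm (n : ℕ) : End (E.obj (LambdaCat.ob p n)) :=
  ∑ j ∈ Finset.range (p * (n + 1)), t E n ^ j

theorem b'_comp_b' (n : ℕ) : b' E (n + 1) ≫ b' E n = 0 :=
  alternating_comp_alternating _ _ _ fun i j hij hj => by
    rw [← E.map_comp, ← E.map_comp, LambdaCat.face_comp_face n i j hij (by lia)]

theorem b_comp_b (n : ℕ) : b E (n + 1) ≫ b E n = 0 :=
  alternating_comp_alternating _ _ _ fun i j hij hj => by
    rw [← E.map_comp, ← E.map_comp, LambdaCat.face_comp_face n i j hij (by lia)]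

theorem t_comp_face_succ (n l : ℕ) (hl : l < n + 1) :
    t E (n + 1) ≫ ((-1 : ℤ) ^ (l + 1) • E.map (LambdaCat.face p n (l + 1))) =
      ((-1 : ℤ) ^ l • E.map (LambdaCat.face p n l)) ≫ t E n := by
  have h := congrArg E.map (LambdaCat.tau_comp_face_succ (p := p) n l (by lia))
  rw [E.map_comp, E.map_comp] at h
  simp only [t, Preadditive.zsmul_comp, Preadditive.comp_zsmul, h, smul_smul]
  congr 1
  ring

theorem t_comp_face_zero (n : ℕ) :
    t E (n + 1) ≫ ((-1 : ℤ) ^ 0 • E.map (LambdaCat.face p n 0)) =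
      (-1 : ℤ) ^ (n + 1) • E.map (LambdaCat.face p n (n + 1)) := by
  have h := congrArg E.map (LambdaCat.tau_comp_face_zero (p := p) n)
  rw [E.map_comp] at h
  simp only [t, Preadditive.zsmul_comp, Preadditive.comp_zsmul, h, smul_smul]
  congr 1
  ring

theorem oneSubT_comp_b (n : ℕ) : oneSubT E (n + 1) ≫ b E n = b' E n ≫ oneSubT E n :=
  one_sub_comp_aux _ _ (fun l => (-1 : ℤ) ^ l • E.map (LambdaCat.face p n l)) (n + 1)
    (fun l hl => t_comp_face_succ E n l hl) (t_comp_face_zero E n)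

theorem norm_comp_b' (n : ℕ) : norm E (n + 1) ≫ b' E n = b E n ≫ norm E n :=
  norm_comp_aux _ _ (fun l => (-1 : ℤ) ^ l • E.map (LambdaCat.face p n l)) (n + 1) p
    (fun l hl => t_comp_face_succ E n l hl) (t_comp_face_zero E n)

theorem t_pow (n j : ℕ) :
    (t E n ^ j : End (E.obj (LambdaCat.ob p n))) =
      ((-1 : ℤ) ^ (n * j) • E.map (LambdaCat.tau p n ^ j : End (LambdaCat.ob p n)) :
        E.obj (LambdaCat.ob p n) ⟶ E.obj (LambdaCat.ob p n)) := by
  induction j with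
  | zero => simp [End.one_def]
  | succ j ih =>
    rw [pow_succ, ih, pow_succ, End.mul_def, End.mul_def, E.map_comp]
    simp only [t, Preadditive.zsmul_comp, Preadditive.comp_zsmul, smul_smul]
    congr 1
    ring

theorem t_pow_mul (n : ℕ) :
    (t E n ^ (p * (n + 1)) : End (E.obj (LambdaCat.ob p n))) = 1 := by
  rw [t_pow, LambdaCat.tau_pow_mul, End.one_def, E.map_id,
    show n * (p * (n + 1)) = p * (n * (n + 1)) by ring,
    ((Nat.even_mul_succ_self n).mul_left p).neg_one_pow, one_smul]
  rfl

theorem oneSubT_comp_norm (n : ℕ) : oneSubT E n ≫ norm E n = 0 := by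
  rw [← End.mul_def, norm, oneSubT, geom_sum_mul_neg, t_pow_mul, sub_self]

theorem norm_comp_oneSubT (n : ℕ) : norm E n ≫ oneSubT E n = 0 := by
  rw [← End.mul_def, norm, oneSubT, mul_neg_geom_sum, t_pow_mul, sub_self]

/-- The `i`-th column of the bicomplex, counted from the right starting from `0`: the terms are
`E([1]), E([2]), …` and the differential is `b` for `i` even and `b'` for `i` odd. -/
def column (i : ℕ) : ChainComplex C ℕ :=
  ChainComplex.of (fun n => E.obj (LambdaCat.ob p n))
    (fun n => if Even i then b E n else b' E n)
    (fun n => by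
      split_ifs
      · exact b_comp_b E n
      · exact b'_comp_b' E n)

/-- The horizontal differential from the column `i + 1` to the column `i`: it is `id - τ` for `i`
even and `id + τ + ⋯ + τ^(p(n + 1) - 1)` for `i` odd. -/
def horizontal (i : ℕ) : column E (i + 1) ⟶ column E i :=
  ChainComplex.ofHom (fun n => if Even i then oneSubT E n else norm E n)
    (fun n => by
      dsimp only [column]
      rw [ChainComplex.of_d, ChainComplex.of_d]
      by_cases h : Even i
      · rw [if_pos h, if_pos h, if_pos h, if_neg (by simpa [Nat.even_add_one] using h)]
        exact oneSubT_comp_b E n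
      · rw [if_neg h, if_neg h, if_neg h, if_pos (by simpa [Nat.even_add_one] using h)]
        exact norm_comp_b' E n)

theorem horizontal_comp_horizontal (i : ℕ) : horizontal E (i + 1) ≫ horizontal E i = 0 := by
  ext n
  change (if Even (i + 1) then oneSubT E n else norm E n) ≫
    (if Even i then oneSubT E n else norm E n) = 0
  by_cases h : Even i
  · rw [if_pos h, if_neg (by simpa [Nat.even_add_one] using h)]
    exact norm_comp_oneSubT E n
  · rw [if_neg h, if_pos (by simpa [Nat.even_add_one] using h)]
    exact oneSubT_comp_norm E n

/-- The bicomplex of the `p`-cyclic object `E`: the term in column `i` (counted from the right) and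
row `n` (counted from the top) is `E([n + 1])`, for `i, n ≥ 0`. -/
def bicomplex : HomologicalComplex₂ C (ComplexShape.down ℕ) (ComplexShape.down ℕ) :=
  ChainComplex.of (column E) (horizontal E) (horizontal_comp_horizontal E)

end

section

variable {E F : LambdaCat p ⥤ C} (f : E ⟶ F)

theorem b'_naturality (n : ℕ) :
    f.app (LambdaCat.ob p (n + 1)) ≫ b' F n = b' E n ≫ f.app (LambdaCat.ob p n) := by
  simp [b', Preadditive.comp_sum, Preadditive.sum_comp]

theorem b_naturality (n : ℕ) :
    f.app (LambdaCat.ob p (n + 1)) ≫ b F n = b E n ≫ f.app (LambdaCat.ob p n) := by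
  simp [b, Preadditive.comp_sum, Preadditive.sum_comp]

theorem t_naturality (n : ℕ) :
    f.app (LambdaCat.ob p n) ≫ t F n = t E n ≫ f.app (LambdaCat.ob p n) := by
  have h := f.naturality (LambdaCat.tau p n)
  simp only [t, Preadditive.comp_zsmul, Preadditive.zsmul_comp, h]

theorem oneSubT_naturality (n : ℕ) :
    f.app (LambdaCat.ob p n) ≫ oneSubT F n = oneSubT E n ≫ f.app (LambdaCat.ob p n) := by
  refine (Preadditive.comp_sub ..).trans (Eq.trans ?_ (Preadditive.sub_comp ..).symm)
  rw [t_naturality, End.one_def, End.one_def, Category.comp_id, Category.id_comp]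

theorem t_pow_naturality (n j : ℕ) :
    f.app (LambdaCat.ob p n) ≫ (t F n ^ j : End _) =
      (t E n ^ j : End _) ≫ f.app (LambdaCat.ob p n) := by
  induction j with
  | zero => simp [End.one_def]
  | succ j ih =>
    rw [pow_succ, pow_succ, End.mul_def, End.mul_def, ← Category.assoc, t_naturality,
      Category.assoc, ih, Category.assoc]

theorem norm_naturality (n : ℕ) :
    f.app (LambdaCat.ob p n) ≫ norm F n = norm E n ≫ f.app (LambdaCat.ob p n) := by
  refine (Preadditive.comp_sum ..).trans (Eq.trans ?_ (Preadditive.sum_comp ..).symm)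
  exact Finset.sum_congr rfl fun j _ => t_pow_naturality f n j

/-- The morphism of columns induced by a morphism of `p`-cyclic objects. -/
def columnMap (i : ℕ) : column E i ⟶ column F i :=
  ChainComplex.ofHom (fun n => f.app (LambdaCat.ob p n))
    (fun n => by
      dsimp only [column]
      rw [ChainComplex.of_d, ChainComplex.of_d]
      by_cases h : Even i
      · rw [if_pos h, if_pos h]
        exact b_naturality f n
      · rw [if_neg h, if_neg h]
        exact b'_naturality f n)

/-- The morphism of bicomplexes induced by a morphism of `p`-cyclic objects. -/
def bicomplexMap : bicomplex E ⟶ bicomplex F :=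
  ChainComplex.ofHom (fun i => columnMap f i)
    (fun i => by
      dsimp only [bicomplex]
      rw [ChainComplex.of_d, ChainComplex.of_d]
      ext n
      change f.app (LambdaCat.ob p n) ≫ (if Even i then oneSubT F n else norm F n) =
        (if Even i then oneSubT E n else norm E n) ≫ f.app (LambdaCat.ob p n)
      by_cases h : Even i
      · rw [if_pos h, if_pos h]
        exact oneSubT_naturality f n
      · rw [if_neg h, if_neg h]
        exact norm_naturality f n)

end

variable (p C) in
/-- The functor sending a `p`-cyclic object to its bicomplex. -/
def bicomplexFunctor : (LambdaCat p ⥤ C) ⥤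
    HomologicalComplex₂ C (ComplexShape.down ℕ) (ComplexShape.down ℕ) where
  obj E := bicomplex E
  map f := bicomplexMap f
  map_id _ := rfl
  map_comp _ _ := rfl

/-- The homology in degree `n` of the total complex of the bicomplex of a `p`-cyclic
`k`-vector space, as a functor of this `p`-cyclic vector space. -/
noncomputable def totalHomology (k : Type u) [Field k] (p n : ℕ) :
    (LambdaCat p ⥤ ModuleCat.{u} k) ⥤ ModuleCat.{u} k :=
  bicomplexFunctor p (ModuleCat.{u} k) ⋙
    HomologicalComplex₂.totalFunctor (ModuleCat.{u} k) (ComplexShape.down ℕ) (ComplexShape.down ℕ)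
      (ComplexShape.down ℕ) ⋙
    HomologicalComplex.homologyFunctor (ModuleCat.{u} k) (ComplexShape.down ℕ) n

end PCyclic

/-! Write `Tot` for the functor sending `E` to the total complex. It is exact, so its homology is a
homological δ-functor. The theorem then reduces to two facts: `H_0 ∘ Tot` is the direct limit, and
`Tot E` has no homology in positive degrees for `E` projective. Dimension shifting along a
projective resolution gives the rest (`nonempty_leftDerived_iso`).

Acyclicity: a projective `E` is a retract of a direct sum of functors `k[Λ_p(c, -)]`, so these sums
suffice. For a class of maps `f : c ⟶ [n+1]`, the residue of `f(0)` modulo `p(n+1)` (the offset) is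
well defined, and `τ` raises it by one. The cyclic group of order `p(n+1)` therefore acts freely on
`Λ_p(c, [n+1])`, with the offset-zero maps as representatives. Hence each value is an induced
module, the rows of the bicomplex are exact away from column zero in every characteristic, and only
the complex of coinvariants with differential `b` remains. It is carried by the offset-zero maps:
every `m_i` fixes `0`, so `b` preserves their span, and `stretch` is an extra degeneracy contracting
it in positive degrees (`stretchLinear_contraction`).

Degree zero: `H_0(Tot E)` is the quotient of `E([1])` by the images of `id - τ` and `m_0 - m_1`.
Every object maps to `[1]`, and these relations identify the effects of any two maps `c ⟶ [1]`
(`LambdaCat.map_comp_eq_of_coequalizes`), so this quotient is the colimit. -/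

/-! ### Comparison of derived functors with an exact complex-valued functor, by dimension shifting.
-/

section DerivedFunctorComparison

variable {A B : Type*} [Category* A] [Category* B] [Abelian A] [Abelian B]

/-- The short complex `opcycles (i + 1) ⟶ X i ⟶ opcycles i` of a chain complex. -/
noncomputable abbrev ChainComplex.syzygyShortComplex (P : ChainComplex A ℕ) (i : ℕ) :
    ShortComplex A :=
  ShortComplex.mk (P.fromOpcycles (i + 1) i) (P.pOpcycles i) (by
    rw [← cancel_epi (P.pOpcycles (i + 1))]
    simp)

/-- The morphism of short complexes `opcycles (i + 1) ⟶ X i ⟶ opcycles i` induced by a morphism of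
chain complexes. -/
noncomputable def ChainComplex.syzygyShortComplexMap {P Q : ChainComplex A ℕ} (φ : P ⟶ Q) (i : ℕ) :
    P.syzygyShortComplex i ⟶ Q.syzygyShortComplex i where
  τ₁ := HomologicalComplex.opcyclesMap φ (i + 1)
  τ₂ := φ.f i
  τ₃ := HomologicalComplex.opcyclesMap φ i
  comm₁₂ := by
    rw [← cancel_epi (P.pOpcycles (i + 1))]
    simp
  comm₂₃ := by simp

/-- The kernel of `fromOpcycles` is the homology in degree `i + 1`, which vanishes. In the middle,
`opcycles i` is the cokernel of the differential, and the differential has the same image as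
`fromOpcycles` because `pOpcycles` is epi. For a resolution, `opcycles i` is thus the `i`-th syzygy.
-/
theorem ChainComplex.syzygyShortComplex_shortExact (P : ChainComplex A ℕ) (i : ℕ)
    (h : P.ExactAt (i + 1)) : (P.syzygyShortComplex i).ShortExact := by
  have hm : Mono (P.fromOpcycles (i + 1) i) :=
    Preadditive.mono_of_isZero_kernel' _ (P.homologyIsKernel (i + 1) i (by simp))
      (h.isZero_homology)
  have he : (P.syzygyShortComplex i).Exact := by
    let T := ShortComplex.mk (P.d (i + 1) i) (P.pOpcycles i) (by simp)
    let π : T ⟶ P.syzygyShortComplex i :=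
      { τ₁ := P.pOpcycles (i + 1)
        τ₂ := 𝟙 _
        τ₃ := 𝟙 _
        comm₁₂ := by simp [T]
        comm₂₃ := by simp [T] }
    have : Epi π.τ₁ := inferInstanceAs (Epi (P.pOpcycles (i + 1)))
    have : IsIso π.τ₂ := inferInstanceAs (IsIso (𝟙 _))
    have : Mono π.τ₃ := inferInstanceAs (Mono (𝟙 _))
    rw [← ShortComplex.exact_iff_of_epi_of_isIso_of_mono π]
    exact T.exact_of_g_is_cokernel (P.opcyclesIsCokernel (i + 1) i (by simp))
  exact { exact := he, mono_f := hm, epi_g := inferInstanceAs (Epi (P.pOpcycles i)) }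

/-- The full subcategory of chain complexes of projective objects that are exact in positive
degrees. -/
def isProjectiveResolution : ObjectProperty (ChainComplex A ℕ) :=
  fun P => (∀ i, Projective (P.X i)) ∧ ∀ i, P.ExactAt (i + 1)

/-- Serves to rewrite two exact sequences with terms in the image of `G`: the one ending in `H_0 ∘
T`, and the one presenting homology as a kernel on opcycles. -/
theorem exact_comp_of_isIso {K X Y Z W : B} (f : K ⟶ X) (g : X ⟶ Z) (h : f ≫ g = 0)
    (hfg : (ShortComplex.mk f g h).Exact) (θ : X ⟶ Y) (_ : IsIso θ) (ω : Z ⟶ W) (_ : IsIso ω)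
    (g' : Y ⟶ W) (hθ : θ ≫ g' = g ≫ ω) : ∃ h', (ShortComplex.mk (f ≫ θ) g' h').Exact :=
  ⟨by rw [Category.assoc, hθ, reassoc_of% h, zero_comp],
    ShortComplex.exact_of_iso (S₁ := ShortComplex.mk f g h)
      (ShortComplex.isoMk (Iso.refl K) (show X ≅ Y from asIso θ) (show Z ≅ W from asIso ω)
        (by simp) (by simp [hθ])) hfg⟩

/-- Two natural monomorphisms whose images are the kernel of the same morphism have isomorphic
sources. -/
theorem nonempty_iso_of_exact {J : Type*} [Category* J] {F F' M : J ⥤ B} (a : F ⟶ M) (b : F' ⟶ M)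
    (N : J → B) (c : ∀ P, M.obj P ⟶ N P) (ha : ∀ P, Mono (a.app P)) (hb : ∀ P, Mono (b.app P))
    (hac : ∀ P, ∃ h, (ShortComplex.mk (a.app P) (c P) h).Exact)
    (hbc : ∀ P, ∃ h, (ShortComplex.mk (b.app P) (c P) h).Exact) : Nonempty (F ≅ F') := by
  choose ha0 ha1 using hac
  choose hb0 hb1 using hbc
  have hf (P) : ∃ f : F.obj P ⟶ F'.obj P, f ≫ b.app P = a.app P :=
    ⟨_, (hb1 P).lift_f (a.app P) (ha0 P)⟩
  have hg (P) : ∃ g : F'.obj P ⟶ F.obj P, g ≫ a.app P = b.app P :=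
    ⟨_, (ha1 P).lift_f (b.app P) (hb0 P)⟩
  choose f hf using hf
  choose g hg using hg
  have hfg (P) : f P ≫ g P = 𝟙 _ := by
    rw [← cancel_mono (a.app P), Category.assoc, hg, hf, Category.id_comp]
  have hgf (P) : g P ≫ f P = 𝟙 _ := by
    rw [← cancel_mono (b.app P), Category.assoc, hf, hg, Category.id_comp]
  refine ⟨NatIso.ofComponents (fun P => ⟨f P, g P, hfg P, hgf P⟩) fun {P Q} φ => ?_⟩
  apply (cancel_mono (b.app Q)).1
  rw [Category.assoc, Category.assoc, hf, a.naturality, b.naturality, reassoc_of% hf P]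

omit [Abelian B] in
theorem naturality_square_trans {X₁ X₂ X₃ X₄ Y₁ Y₂ Y₃ Y₄ : B} {d₁ : X₁ ⟶ Y₁} {d₂ : X₂ ⟶ Y₂}
    {d₃ : X₃ ⟶ Y₃} {d₄ : X₄ ⟶ Y₄} {f₁ : X₁ ⟶ X₂} {f₂ : X₂ ⟶ X₃} {f₃ : X₃ ⟶ X₄} {g₁ : Y₁ ⟶ Y₂}
    {g₂ : Y₂ ⟶ Y₃} {g₃ : Y₃ ⟶ Y₄} (h₁ : d₁ ≫ g₁ = f₁ ≫ d₂) (h₂ : f₂ ≫ d₃ = d₂ ≫ g₂)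
    (h₃ : f₃ ≫ d₄ = d₃ ≫ g₃) : d₁ ≫ g₁ ≫ g₂ ≫ g₃ = (f₁ ≫ f₂ ≫ f₃) ≫ d₄ := by
  rw [reassoc_of% h₁, ← reassoc_of% h₂, ← h₃, Category.assoc, Category.assoc]

variable (T : A ⥤ ChainComplex B ℕ)

/-- The functor sending a resolution `P` to `H_j (T (opcycles i))`. -/
noncomputable abbrev syzygyHomology (i j : ℕ) :
    (isProjectiveResolution (A := A)).FullSubcategory ⥤ B :=
  isProjectiveResolution.ι ⋙ HomologicalComplex.opcyclesFunctor A _ i ⋙ T ⋙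
    HomologicalComplex.homologyFunctor B _ j

variable [T.PreservesZeroMorphisms]
  (hT : ∀ S : ShortComplex A, S.ShortExact → (S.map T).ShortExact)
  (hP : ∀ X : A, Projective X → ∀ j, IsZero ((T.obj X).homology (j + 1)))

/-- The connecting homomorphism `H_{j+1} (T (opcycles i)) ⟶ H_j (T (opcycles (i + 1)))`. -/
noncomputable def syzygyδ (i j : ℕ) : syzygyHomology T i (j + 1) ⟶ syzygyHomology T (i + 1) j where
  app P := (hT _ (P.obj.syzygyShortComplex_shortExact i (P.property.2 i))).δ (j + 1) j rfl
  naturality P Q φ := by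
    have h := HomologicalComplex.HomologySequence.δ_naturality
      (T.mapShortComplex.map (ChainComplex.syzygyShortComplexMap φ.hom i))
      (hT _ (P.obj.syzygyShortComplex_shortExact i (P.property.2 i)))
      (hT _ (Q.obj.syzygyShortComplex_shortExact i (Q.property.2 i))) (j + 1) j rfl
    exact h.symm

include hP in
theorem mono_syzygyδ_app (i j : ℕ) (P) : Mono ((syzygyδ T hT i j).app P) :=
  (hT _ (P.obj.syzygyShortComplex_shortExact i (P.property.2 i))).mono_δ _ _ _
    (hP _ (P.property.1 i) j)

include hP in
theorem isIso_syzygyδ (i j : ℕ) : IsIso (syzygyδ T hT i (j + 1)) := by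
  have (P : (isProjectiveResolution (A := A)).FullSubcategory) :
      IsIso ((syzygyδ T hT i (j + 1)).app P) :=
    (hT _ (P.obj.syzygyShortComplex_shortExact i (P.property.2 i))).isIso_δ _ _ _
      (hP _ (P.property.1 i) _) (hP _ (P.property.1 i) _)
  exact NatIso.isIso_of_isIso_app _

variable (G : A ⥤ B) [G.Additive]

/-- The functor sending a resolution `P` to `H_n (G P)`. -/
noncomputable abbrev resolutionHomology (n : ℕ) :
    (isProjectiveResolution (A := A)).FullSubcategory ⥤ B :=
  isProjectiveResolution.ι ⋙ G.mapHomologicalComplex _ ⋙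
    HomologicalComplex.homologyFunctor B _ n

/-- The image under `G` of the projection from `P.X i` to the opcycles of `P`. -/
noncomputable def mapPOpcycles (P : ChainComplex A ℕ) (i : ℕ) :
    ((G.mapHomologicalComplex (ComplexShape.down ℕ)).obj P).X i ⟶ G.obj (P.opcycles i) :=
  G.map (P.pOpcycles i)

/-- The image under `G` of the morphism from the opcycles of `P` to `P.X j`. -/
noncomputable def mapFromOpcycles (P : ChainComplex A ℕ) (i j : ℕ) :
    G.obj (P.opcycles i) ⟶ ((G.mapHomologicalComplex (ComplexShape.down ℕ)).obj P).X j :=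
  G.map (P.fromOpcycles i j)

theorem d_mapPOpcycles (P : ChainComplex A ℕ) (i j : ℕ) :
    ((G.mapHomologicalComplex (ComplexShape.down ℕ)).obj P).d i j ≫ mapPOpcycles G P j = 0 :=
  (G.map_comp _ _).symm.trans ((congrArg G.map (P.d_pOpcycles i j)).trans (G.map_zero _ _))

theorem mapPOpcycles_mapFromOpcycles (P : ChainComplex A ℕ) (i j : ℕ) :
    mapPOpcycles G P i ≫ mapFromOpcycles G P i j =
      ((G.mapHomologicalComplex (ComplexShape.down ℕ)).obj P).d i j :=
  (G.map_comp _ _).symm.trans (congrArg G.map (P.p_fromOpcycles i j))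

theorem mapPOpcycles_naturality {P Q : ChainComplex A ℕ} (φ : P ⟶ Q) (i : ℕ) :
    ((G.mapHomologicalComplex (ComplexShape.down ℕ)).map φ).f i ≫ mapPOpcycles G Q i =
      mapPOpcycles G P i ≫ G.map (HomologicalComplex.opcyclesMap φ i) :=
  (G.map_comp _ _).symm.trans ((congrArg G.map (HomologicalComplex.p_opcyclesMap φ i)).symm.trans
    (G.map_comp _ _))

/-- The canonical map from the opcycles of `G P` to the image under `G` of those of `P`. -/
noncomputable def opcyclesComparison (P : ChainComplex A ℕ) (i : ℕ) :
    ((G.mapHomologicalComplex (ComplexShape.down ℕ)).obj P).opcycles i ⟶ G.obj (P.opcycles i) :=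
  HomologicalComplex.descOpcycles _ (mapPOpcycles G P i) (i + 1) (by simp) (d_mapPOpcycles G P _ _)

theorem p_opcyclesComparison (P : ChainComplex A ℕ) (i : ℕ) :
    HomologicalComplex.pOpcycles _ i ≫ opcyclesComparison G P i = mapPOpcycles G P i :=
  HomologicalComplex.p_descOpcycles _ _ _ _ _

theorem opcyclesComparison_naturality {P Q : ChainComplex A ℕ} (φ : P ⟶ Q) (i : ℕ) :
    HomologicalComplex.opcyclesMap ((G.mapHomologicalComplex (ComplexShape.down ℕ)).map φ) i ≫
      opcyclesComparison G Q i =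
    opcyclesComparison G P i ≫ G.map (HomologicalComplex.opcyclesMap φ i) := by
  rw [← cancel_epi (HomologicalComplex.pOpcycles _ i), HomologicalComplex.p_opcyclesMap_assoc,
    p_opcyclesComparison, reassoc_of% p_opcyclesComparison G P i, mapPOpcycles_naturality]

theorem opcyclesComparison_fromOpcycles (P : ChainComplex A ℕ) (i j : ℕ) :
    opcyclesComparison G P i ≫ mapFromOpcycles G P i j =
      HomologicalComplex.fromOpcycles _ i j := by
  rw [← cancel_epi (HomologicalComplex.pOpcycles _ i), reassoc_of% p_opcyclesComparison G P i,
    mapPOpcycles_mapFromOpcycles, HomologicalComplex.p_fromOpcycles]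

/-- A right exact functor preserves the cokernel presentation of the opcycles. -/
noncomputable def mapPOpcyclesIsCokernel [PreservesFiniteColimits G] (P : ChainComplex A ℕ)
    (i : ℕ) : IsColimit (CokernelCofork.ofπ (mapPOpcycles G P i) (d_mapPOpcycles G P (i + 1) i)) :=
  CokernelCofork.mapIsColimit _ (P.opcyclesIsCokernel (i + 1) i (by simp)) G

instance isIso_opcyclesComparison [PreservesFiniteColimits G] (P : ChainComplex A ℕ) (i : ℕ) :
    IsIso (opcyclesComparison G P i) := by
  have h1 := mapPOpcyclesIsCokernel G P i
  have h2 := ((G.mapHomologicalComplex (ComplexShape.down ℕ)).obj P).opcyclesIsCokernel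
    (i + 1) i (by simp)
  have e : opcyclesComparison G P i = (h2.coconePointUniqueUpToIso h1).hom := by
    rw [← cancel_epi (HomologicalComplex.pOpcycles _ i), p_opcyclesComparison]
    exact (h2.comp_coconePointUniqueUpToIso_hom h1 WalkingParallelPair.one).symm
  rw [e]
  infer_instance

/-- The canonical map `H_n (G P) ⟶ G (opcycles n)`. -/
noncomputable def resolutionHomologyιApp (P : ChainComplex A ℕ) (n : ℕ) :
    ((G.mapHomologicalComplex (ComplexShape.down ℕ)).obj P).homology n ⟶ G.obj (P.opcycles n) :=
  HomologicalComplex.homologyι _ n ≫ opcyclesComparison G P n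

theorem resolutionHomologyιApp_naturality {P Q : ChainComplex A ℕ} (φ : P ⟶ Q) (n : ℕ) :
    HomologicalComplex.homologyMap ((G.mapHomologicalComplex (ComplexShape.down ℕ)).map φ) n ≫
      resolutionHomologyιApp G Q n =
    resolutionHomologyιApp G P n ≫ G.map (HomologicalComplex.opcyclesMap φ n) := by
  rw [resolutionHomologyιApp, resolutionHomologyιApp, Category.assoc,
    HomologicalComplex.homologyι_naturality_assoc, opcyclesComparison_naturality]

theorem mono_resolutionHomologyιApp [PreservesFiniteColimits G] (P : ChainComplex A ℕ) (n : ℕ) :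
    Mono (resolutionHomologyιApp G P n) :=
  mono_comp _ _

/-- Homology is the kernel of `fromOpcycles` on the complex `G P`; right exactness of `G` lets the
opcycles of `G P` be replaced by `G` of the opcycles of `P`. -/
theorem resolutionHomologyιApp_exact [PreservesFiniteColimits G] (P : ChainComplex A ℕ) (i : ℕ) :
    ∃ h, (ShortComplex.mk (resolutionHomologyιApp G P (i + 1)) (G.map (P.fromOpcycles (i + 1) i))
      h).Exact := by
  have h := (ShortComplex.mk _ _ (HomologicalComplex.homologyι_comp_fromOpcycles _ (i + 1)
    i)).exact_of_f_is_kernel (HomologicalComplex.homologyIsKernel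
      ((G.mapHomologicalComplex (ComplexShape.down ℕ)).obj P) (i + 1) i (by simp))
  exact exact_comp_of_isIso _ _ _ h (opcyclesComparison G P (i + 1)) inferInstance
    (𝟙 _) inferInstance
    (mapFromOpcycles G P (i + 1) i)
    ((opcyclesComparison_fromOpcycles G P (i + 1) i).trans (Category.comp_id _).symm)

variable [PreservesFiniteColimits G]
  (e : T ⋙ HomologicalComplex.homologyFunctor B (ComplexShape.down ℕ) 0 ≅ G)

/-- The canonical natural transformation `H_n (G P) ⟶ G (opcycles n)`. -/
noncomputable def resolutionHomologyι (n : ℕ) : resolutionHomology G n ⟶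
    isProjectiveResolution.ι ⋙ HomologicalComplex.opcyclesFunctor A _ n ⋙ G where
  app P := resolutionHomologyιApp G P.obj n
  naturality _ _ φ := resolutionHomologyιApp_naturality G φ.hom n

/-- The connecting homomorphism `H_1 (T (opcycles i)) ⟶ G (opcycles (i + 1))`. -/
noncomputable def syzygyδZero (i : ℕ) : syzygyHomology T i 1 ⟶
    isProjectiveResolution.ι ⋙ HomologicalComplex.opcyclesFunctor A _ (i + 1) ⋙ G :=
  syzygyδ T hT i 0 ≫ Functor.whiskerLeft (isProjectiveResolution.ι ⋙
    HomologicalComplex.opcyclesFunctor A _ (i + 1)) e.hom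

omit [G.Additive] [PreservesFiniteColimits G] in
theorem syzygyδZero_exact (i : ℕ) (P : (isProjectiveResolution (A := A)).FullSubcategory) :
    ∃ h, (ShortComplex.mk ((syzygyδZero T hT G e i).app P)
      (G.map (P.obj.fromOpcycles (i + 1) i)) h).Exact := by
  have hS := hT _ (P.obj.syzygyShortComplex_shortExact i (P.property.2 i))
  have he (X : A) : IsIso (e.hom.app X) := inferInstance
  exact exact_comp_of_isIso _ _ _ (hS.homology_exact₁ 1 0 rfl)
    (e.hom.app (P.obj.opcycles (i + 1))) (he _) (e.hom.app (P.obj.X i)) (he _) _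
    (e.hom.naturality (P.obj.fromOpcycles (i + 1) i)).symm

omit [G.Additive] [PreservesFiniteColimits G] in
include hP in
theorem mono_syzygyδZero_app (i : ℕ) (P) : Mono ((syzygyδZero T hT G e i).app P) := by
  have h1 := mono_syzygyδ_app T hT hP i 0 P
  have h2 : Mono (e.hom.app (P.obj.opcycles (i + 1))) := inferInstance
  exact @mono_comp _ _ _ _ _ _ h1 _ h2

-- Both sides are the kernel of `G (opcycles (i + 1)) ⟶ G (X i)`: the left one by the long exact
-- sequence, since `H_1 (T (X i))` vanishes, the right one because `G` is right exact.
include hT hP e in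
theorem nonempty_syzygyHomology_one_iso (i : ℕ) :
    Nonempty (syzygyHomology T i 1 ≅ resolutionHomology G (i + 1)) :=
  nonempty_iso_of_exact (syzygyδZero T hT G e i) (resolutionHomologyι G (i + 1))
    (fun P => G.obj (P.obj.X i)) (fun P => G.map (P.obj.fromOpcycles (i + 1) i))
    (mono_syzygyδZero_app T hT hP G e i) (fun P => mono_resolutionHomologyιApp G P.obj (i + 1))
    (syzygyδZero_exact T hT G e i) (fun P => resolutionHomologyιApp_exact G P.obj i)

-- Dimension shifting: each connecting isomorphism lowers the homological degree by one and raises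
-- the syzygy index by one, until degree one is reached.
include hT hP e in
theorem nonempty_syzygyHomology_iso (j i n : ℕ) (hn : i + j + 1 = n) :
    Nonempty (syzygyHomology T i (j + 1) ≅ resolutionHomology G n) := by
  induction j generalizing i with
  | zero =>
    subst hn
    exact nonempty_syzygyHomology_one_iso T hT hP G e i
  | succ j ih =>
    obtain ⟨h⟩ := ih (i + 1) (by lia)
    have := isIso_syzygyδ T hT hP i j
    exact ⟨asIso (syzygyδ T hT i (j + 1)) ≪≫ h⟩

/-- The resolution underlying a `ProjectiveResolution`. -/
abbrev CategoryTheory.ProjectiveResolution.toFullSubcategory {X : A} (P : ProjectiveResolution X) :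
    (isProjectiveResolution (A := A)).FullSubcategory :=
  ⟨P.complex, P.projective, P.complex_exactAt_succ⟩

/-- The degree zero opcycles of a projective resolution of `X` are `X`. -/
noncomputable def CategoryTheory.ProjectiveResolution.opcyclesIso {X : A}
    (P : ProjectiveResolution X) : P.complex.opcycles 0 ≅ X :=
  (P.complex.opcyclesIsCokernel 1 0 (by simp)).coconePointUniqueUpToIso P.isColimitCokernelCofork

theorem CategoryTheory.ProjectiveResolution.p_opcyclesIso_hom {X : A}
    (P : ProjectiveResolution X) : P.complex.pOpcycles 0 ≫ P.opcyclesIso.hom = P.π.f 0 :=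
  (P.complex.opcyclesIsCokernel 1 0 (by simp)).comp_coconePointUniqueUpToIso_hom
    P.isColimitCokernelCofork WalkingParallelPair.one

theorem CategoryTheory.ProjectiveResolution.opcyclesIso_hom_naturality {X Y : A}
    (P : ProjectiveResolution X) (Q : ProjectiveResolution Y) (f : X ⟶ Y)
    (φ : P.complex ⟶ Q.complex) (hφ : φ.f 0 ≫ Q.π.f 0 = P.π.f 0 ≫ f) :
    P.opcyclesIso.hom ≫ f = HomologicalComplex.opcyclesMap φ 0 ≫ Q.opcyclesIso.hom := by
  rw [← cancel_epi (HomologicalComplex.pOpcycles _ 0), HomologicalComplex.p_opcyclesMap_assoc,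
    reassoc_of% P.p_opcyclesIso_hom, Q.p_opcyclesIso_hom]
  exact hφ.symm

include hT hP e in
/-- A functor with values in chain complexes that is exact and acyclic on projective objects
computes the left derived functors of its homology in degree zero. -/
theorem nonempty_leftDerived_iso [HasProjectiveResolutions A] (n : ℕ) :
    Nonempty (G.leftDerived n ≅ T ⋙ HomologicalComplex.homologyFunctor B _ n) := by
  cases n with
  | zero => exact ⟨G.leftDerivedZeroIsoSelf ≪≫ e.symm⟩
  | succ n =>
    obtain ⟨h⟩ := nonempty_syzygyHomology_iso T hT hP G e n 0 (n + 1) (by lia)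
    let R (X : A) := (projectiveResolution X).toFullSubcategory
    refine ⟨NatIso.ofComponents (fun X =>
      (projectiveResolution X).isoLeftDerivedObj G (n + 1) ≪≫ h.symm.app (R X) ≪≫
        (T ⋙ HomologicalComplex.homologyFunctor B _ (n + 1)).mapIso
          (projectiveResolution X).opcyclesIso) fun {X Y} f => ?_⟩
    -- All three isomorphisms are natural in maps of resolutions, so any lift of `f` to the chosen
    -- resolutions gives naturality in `X`.
    let φ : (projectiveResolution X).complex ⟶ (projectiveResolution Y).complex :=
      ProjectiveResolution.lift f _ _
    have hφ : φ.f 0 ≫ (projectiveResolution Y).π.f 0 = (projectiveResolution X).π.f 0 ≫ f :=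
      ProjectiveResolution.lift_commutes_zero f _ _
    let ψ : R X ⟶ R Y := ⟨φ⟩
    have h1 := ProjectiveResolution.isoLeftDerivedObj_hom_naturality f _ _ φ hφ G (n + 1)
    have h2 : h.inv.app (R X) ≫ (syzygyHomology T 0 (n + 1)).map ψ =
      (resolutionHomology G (n + 1)).map ψ ≫ h.inv.app (R Y) := (h.inv.naturality ψ).symm
    have h3 := (Functor.map_comp _ _ _).symm.trans
      ((congrArg (T ⋙ HomologicalComplex.homologyFunctor B _ (n + 1)).map
        ((projectiveResolution X).opcyclesIso_hom_naturality _ f φ hφ)).trans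
          (Functor.map_comp _ _ _))
    exact naturality_square_trans h1 h2 h3

end DerivedFunctorComparison

/-! ### Coordinates on the total complex of a first-quadrant bicomplex. -/

section TotalComplex

variable {C : Type*} [Category* C] [Preadditive C]
  (K L : HomologicalComplex₂ C (ComplexShape.down ℕ) (ComplexShape.down ℕ))
  [K.HasTotal (ComplexShape.down ℕ)] [L.HasTotal (ComplexShape.down ℕ)]

namespace HomologicalComplex₂

/-- The projection of the degree `n` part of the total complex to the summand `(i, j)`; it is zero
unless `i + j = n`. -/
noncomputable def πTotal (i j n : ℕ) : (K.total (ComplexShape.down ℕ)).X n ⟶ (K.X i).X j :=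
  K.totalDesc fun i' j' _ =>
    if h : i' = i ∧ j' = j then (K.XXIsoOfEq _ _ _ h.1 h.2).hom else 0

theorem ι_πTotal (i j n : ℕ) (h : i + j = n) :
    K.ιTotal (ComplexShape.down ℕ) i j n h ≫ K.πTotal i j n = 𝟙 _ := by
  simp [πTotal]

theorem ι_πTotal_of_ne (i j i' j' n : ℕ) (h : i' + j' = n) (hij : ¬ (i' = i ∧ j' = j)) :
    K.ιTotal (ComplexShape.down ℕ) i' j' n h ≫ K.πTotal i j n = 0 := by
  rw [πTotal, ι_totalDesc, dif_neg hij]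

theorem sum_πTotal_ι (n : ℕ) :
    ∑ x ∈ Finset.HasAntidiagonal.antidiagonal n, K.πTotal x.1 x.2 n ≫
      K.ιTotalOrZero (ComplexShape.down ℕ) x.1 x.2 n = 𝟙 _ := by
  apply total.hom_ext
  intro i j h
  rw [Preadditive.comp_sum, Category.comp_id, Finset.sum_eq_single (i, j)]
  · rw [← Category.assoc, ι_πTotal, Category.id_comp, ιTotalOrZero_eq]
  · intro x _ hx
    rw [← Category.assoc, ι_πTotal_of_ne, zero_comp]
    rintro ⟨rfl, rfl⟩
    exact hx rfl
  · intro hx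
    exact absurd (Finset.HasAntidiagonal.mem_antidiagonal.2 h) hx

variable {K L} in
theorem map_πTotal (φ : K ⟶ L) (i j n : ℕ) :
    (total.map φ (ComplexShape.down ℕ)).f n ≫ L.πTotal i j n =
      K.πTotal i j n ≫ (φ.f i).f j := by
  apply total.hom_ext
  intro i' j' h
  rw [ιTotal_map_assoc]
  by_cases hij : i' = i ∧ j' = j
  · obtain ⟨rfl, rfl⟩ := hij
    rw [ι_πTotal, ← Category.assoc, ι_πTotal, Category.id_comp, Category.comp_id]
  · rw [ι_πTotal_of_ne _ _ _ _ _ _ _ hij, ← Category.assoc, ι_πTotal_of_ne _ _ _ _ _ _ _ hij,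
      zero_comp, comp_zero]

theorem d_πTotal (i j n : ℕ) (h : i + j = n) :
    (K.total (ComplexShape.down ℕ)).d (n + 1) n ≫ K.πTotal i j n =
      K.πTotal (i + 1) j (n + 1) ≫ (K.d (i + 1) i).f j +
        (-1 : ℤ) ^ i • (K.πTotal i (j + 1) (n + 1) ≫ (K.X i).d (j + 1) j) := by
  apply total.hom_ext
  intro i' j' h'
  change i' + j' = n + 1 at h'
  rw [total_d, Preadditive.add_comp, Preadditive.comp_add, Preadditive.comp_add, ι_D₁_assoc,
    ι_D₂_assoc, Preadditive.comp_zsmul]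
  congr 1
  · rcases i' with _ | i'
    · rw [d₁_eq_zero _ _ _ _ _ (by simp), zero_comp, ← Category.assoc,
        ι_πTotal_of_ne _ _ _ _ _ _ _ (by lia), zero_comp]
    · rw [d₁_eq K _ (i₁' := i') rfl _ _ (show i' + j' = n by lia)]
      change ((1 : ℤˣ) • _) ≫ _ = _
      rw [one_smul, Category.assoc]
      by_cases hij : i' = i ∧ j' = j
      · obtain ⟨rfl, rfl⟩ := hij
        rw [ι_πTotal, ← Category.assoc, ι_πTotal, Category.id_comp, Category.comp_id]
      · rw [ι_πTotal_of_ne _ _ _ _ _ _ _ hij, ← Category.assoc,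
          ι_πTotal_of_ne _ _ _ _ _ _ _ (by lia), zero_comp, comp_zero]
  · rcases j' with _ | j'
    · rw [d₂_eq_zero _ _ _ _ _ (by simp), zero_comp, ← Category.assoc,
        ι_πTotal_of_ne _ _ _ _ _ _ _ (by lia), zero_comp, smul_zero]
    · rw [d₂_eq K _ _ (i₂' := j') rfl _ (show i' + j' = n by lia)]
      change ((((-1 : ℤˣ) ^ i' : ℤˣ) : ℤ) • _) ≫ _ = _
      rw [Preadditive.zsmul_comp, Category.assoc]
      by_cases hij : i' = i ∧ j' = j
      · obtain ⟨rfl, rfl⟩ := hij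
        rw [ι_πTotal, ← Category.assoc (K.ιTotal _ _ _ _ _), ι_πTotal, Category.id_comp,
          Category.comp_id]
        simp
      · rw [ι_πTotal_of_ne _ _ _ _ _ _ _ hij, ← Category.assoc (K.ιTotal _ _ _ _ _),
          ι_πTotal_of_ne _ _ _ _ _ _ _ (by lia), zero_comp, comp_zero, smul_zero, smul_zero]

end HomologicalComplex₂

end TotalComplex

/-! ### Acyclicity of a total complex with exact rows. -/

section TotalComplexModule

variable {k : Type u} [Field k]
  (K : HomologicalComplex₂ (ModuleCat.{u} k) (ComplexShape.down ℕ) (ComplexShape.down ℕ))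

namespace HomologicalComplex₂

/-- Together with `exists_total`, this presents the degree `n` part as the finite product of its
summands, so that arguments can be made coordinatewise. -/
theorem total_ext (n : ℕ) {x y : (K.total (ComplexShape.down ℕ)).X n}
    (h : ∀ i j, i + j = n → K.πTotal i j n x = K.πTotal i j n y) : x = y := by
  have key (z : (K.total (ComplexShape.down ℕ)).X n) :
      z = ∑ a ∈ Finset.HasAntidiagonal.antidiagonal n, K.ιTotalOrZero (ComplexShape.down ℕ) a.1 a.2 n
        (K.πTotal a.1 a.2 n z) := by
    have h1 := congrArg (fun f => f.hom z) (K.sum_πTotal_ι n)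
    simpa [ModuleCat.hom_sum] using h1.symm
  rw [key x, key y]
  exact Finset.sum_congr rfl fun a ha => by rw [h _ _ (Finset.HasAntidiagonal.mem_antidiagonal.1 ha)]

theorem exists_total (n : ℕ) (y : ∀ i j, (K.X i).X j) :
    ∃ x : (K.total (ComplexShape.down ℕ)).X n, ∀ i j, i + j = n → K.πTotal i j n x = y i j := by
  refine ⟨∑ a ∈ Finset.HasAntidiagonal.antidiagonal n, K.ιTotalOrZero (ComplexShape.down ℕ) a.1 a.2 n
    (y a.1 a.2), fun i j hij => ?_⟩
  rw [map_sum, Finset.sum_eq_single (i, j)]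
  · rw [ιTotalOrZero_eq _ _ _ _ _ hij]
    exact congrArg (fun f => f.hom (y i j)) (K.ι_πTotal i j n hij)
  · intro x hx hx'
    rw [ιTotalOrZero_eq _ _ _ _ _ (Finset.HasAntidiagonal.mem_antidiagonal.1 hx)]
    refine congrArg (fun f => f.hom (y x.1 x.2)) (K.ι_πTotal_of_ne i j x.1 x.2 n
      (Finset.HasAntidiagonal.mem_antidiagonal.1 hx) ?_)
    rintro ⟨rfl, rfl⟩
    exact hx' rfl
  · intro hx
    exact absurd (Finset.HasAntidiagonal.mem_antidiagonal.2 hij) hx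

theorem πTotal_d_apply (i j n : ℕ) (h : i + j = n)
    (x : (K.total (ComplexShape.down ℕ)).X (n + 1)) :
    K.πTotal i j n ((K.total (ComplexShape.down ℕ)).d (n + 1) n x) =
      (K.d (i + 1) i).f j (K.πTotal (i + 1) j (n + 1) x) +
        (-1 : ℤ) ^ i • (K.X i).d (j + 1) j (K.πTotal i (j + 1) (n + 1) x) :=
  congrArg (fun f => f.hom x) (K.d_πTotal i j n h)

theorem πTotal_map_apply {L : HomologicalComplex₂ (ModuleCat.{u} k) (ComplexShape.down ℕ)
    (ComplexShape.down ℕ)} (φ : K ⟶ L) (i j n : ℕ) (x : (K.total (ComplexShape.down ℕ)).X n) :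
    L.πTotal i j n ((total.map φ (ComplexShape.down ℕ)).f n x) =
      (φ.f i).f j (K.πTotal i j n x) :=
  congrArg (fun f => f.hom x) (map_πTotal φ i j n)

/-- If the rows of a bicomplex are exact away from the column `0`, and the complex of cokernels of
the horizontal differentials from column `1` to column `0` is exact in positive degrees, then the
total complex is exact in positive degrees. -/
theorem total_exact
    (hrow : ∀ i j (x : (K.X (i + 1)).X j), (K.d (i + 1) i).f j x = 0 →
      ∃ y, (K.d (i + 2) (i + 1)).f j y = x)
    (hcol : ∀ j (x : (K.X 0).X (j + 1)) (w : (K.X 1).X j),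
      (K.X 0).d (j + 1) j x = (K.d 1 0).f j w →
      ∃ y z, x = (K.X 0).d (j + 2) (j + 1) y + (K.d 1 0).f (j + 1) z)
    (n : ℕ) (x : (K.total (ComplexShape.down ℕ)).X (n + 1))
    (hx : (K.total (ComplexShape.down ℕ)).d (n + 1) n x = 0) :
    ∃ y, (K.total (ComplexShape.down ℕ)).d (n + 2) (n + 1) y = x := by
  -- The primitive of `x` is built column by column: after stage `m` its boundary agrees with `x` in
  -- the columns below `m`.
  have key (m : ℕ) (hm : 1 ≤ m) : ∃ y, ∀ i j, i < m → i + j = n + 1 →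
      K.πTotal i j (n + 1) ((K.total (ComplexShape.down ℕ)).d (n + 2) (n + 1) y) =
        K.πTotal i j (n + 1) x := by
    induction m, hm using Nat.le_induction with
    | base =>
      -- The `(0, n)` coordinate of `d x = 0` says that the vertical image of the column-zero
      -- coordinate is minus the horizontal image of the column-one coordinate.
      obtain ⟨y, z, hyz⟩ := hcol n (K.πTotal 0 (n + 1) (n + 1) x) (-K.πTotal 1 n (n + 1) x) (by
        have h := K.πTotal_d_apply 0 n n (by lia) x
        rw [hx, map_zero, pow_zero, one_smul] at h
        rw [map_neg]
        exact (neg_eq_of_add_eq_zero_right h.symm).symm)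
      obtain ⟨v, hv⟩ := K.exists_total (n + 2) fun i j =>
        if h : 0 = i ∧ n + 2 = j then (K.XXIsoOfEq _ _ _ h.1 h.2).hom y
        else if h : 1 = i ∧ n + 1 = j then (K.XXIsoOfEq _ _ _ h.1 h.2).hom z else 0
      refine ⟨v, fun i j hi hij => ?_⟩
      obtain rfl : i = 0 := by lia
      obtain rfl : j = n + 1 := by lia
      have h0 := hv 0 (n + 2) (by lia)
      have h1 := hv 1 (n + 1) (by lia)
      rw [dif_pos ⟨rfl, rfl⟩] at h0
      rw [dif_neg (by lia), dif_pos ⟨rfl, rfl⟩] at h1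
      rw [πTotal_d_apply _ _ _ _ (by lia), hyz]
      change (K.d 1 0).f (n + 1) (K.πTotal 1 (n + 1) (n + 2) v) + (-1 : ℤ) ^ 0 •
        (K.X 0).d (n + 2) (n + 1) (K.πTotal 0 (n + 2) (n + 2) v) = _
      rw [h0, h1, pow_zero, one_smul]
      refine (add_comm _ _).trans ?_
      simp
    | succ m hm ih =>
      obtain ⟨y, hy⟩ := ih
      by_cases hmn : m ≤ n + 1
      · obtain ⟨m, rfl⟩ : ∃ m', m = m' + 1 := ⟨m - 1, by lia⟩
        obtain ⟨j, rfl⟩ : ∃ j, n = m + j := ⟨n - m, by lia⟩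
        -- The error `r` is a cycle vanishing in columns up to `m`, so its coordinate in column `m +
        -- 1` is killed by the horizontal differential and lifts to some `z` in column `m + 2`.
        -- Adding `z` does not disturb the earlier columns; its vertical boundary lies in column `m
        -- + 2`, not yet considered.
        let r := x - (K.total (ComplexShape.down ℕ)).d (m + j + 2) (m + j + 1) y
        have hr : (K.total (ComplexShape.down ℕ)).d (m + j + 1) (m + j) r = 0 := by
          have h := congrArg (fun f => f.hom y) ((K.total (ComplexShape.down ℕ)).d_comp_d
            (m + j + 2) (m + j + 1) (m + j))
          simp only [r, map_sub, hx, zero_sub, neg_eq_zero]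
          exact h
        have hr0 : K.πTotal m (j + 1) (m + j + 1) r = 0 := by
          simp only [r, map_sub, hy m (j + 1) (by lia) (by lia), sub_self]
        obtain ⟨z, hz⟩ := hrow m j (K.πTotal (m + 1) j (m + j + 1) r) (by
          have h := K.πTotal_d_apply m j (m + j) rfl r
          rw [hr, hr0, map_zero, map_zero, smul_zero, add_zero] at h
          exact h.symm)
        obtain ⟨v, hv⟩ := K.exists_total (m + j + 2) fun i' j' =>
          if h : m + 2 = i' ∧ j = j' then (K.XXIsoOfEq _ _ _ h.1 h.2).hom z else 0
        refine ⟨y + v, fun i' j' hi hij => ?_⟩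
        rw [map_add, map_add, πTotal_d_apply _ _ _ _ (by lia) v,
          hv i' (j' + 1) (by lia), dif_neg (by lia), map_zero, smul_zero, add_zero,
          hv (i' + 1) j' (by lia)]
        by_cases him : i' = m + 1
        · subst him
          obtain rfl : j = j' := by lia
          rw [dif_pos ⟨rfl, rfl⟩]
          have hz' : (K.d (m + 1 + 1) (m + 1)).f j z = K.πTotal (m + 1) j (m + j + 1) x -
              K.πTotal (m + 1) j (m + j + 1)
                ((K.total (ComplexShape.down ℕ)).d (m + j + 2) (m + j + 1) y) := by
            rw [← map_sub]
            exact hz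
          simp [hz']
        · rw [dif_neg (by lia), map_zero, add_zero]
          exact hy _ _ (by lia) hij
      · exact ⟨y, fun i j _ hij => hy i j (by lia) hij⟩
  obtain ⟨y, hy⟩ := key (n + 2) (by lia)
  exact ⟨y, K.total_ext _ fun i j hij => hy i j (by lia) hij⟩

end HomologicalComplex₂

end TotalComplexModule

/-! ### Exactness of the total complex functor, and an acyclicity criterion in terms of `τ` and `b`.
-/

namespace PCyclic

variable {k : Type u} [Field k] {p : ℕ}

variable (k p) in
/-- The functor sending a `p`-cyclic vector space to the total complex of its bicomplex. -/
noncomputable def totalComplex :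
    (LambdaCat p ⥤ ModuleCat.{u} k) ⥤ ChainComplex (ModuleCat.{u} k) ℕ :=
  bicomplexFunctor p (ModuleCat.{u} k) ⋙
    HomologicalComplex₂.totalFunctor (ModuleCat.{u} k) (ComplexShape.down ℕ) (ComplexShape.down ℕ)
      (ComplexShape.down ℕ)

/-- The projection of the degree `n` part of the total complex to the summand `(i, j)`; it is zero
unless `i + j = n`. -/
noncomputable def totalπ (E : LambdaCat p ⥤ ModuleCat.{u} k) (i j n : ℕ) :
    ((totalComplex k p).obj E).X n ⟶ E.obj (LambdaCat.ob p j) :=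
  (bicomplex E).πTotal i j n

theorem totalComplex_ext (E : LambdaCat p ⥤ ModuleCat.{u} k) (n : ℕ)
    {x y : ((totalComplex k p).obj E).X n}
    (h : ∀ i j, i + j = n → totalπ E i j n x = totalπ E i j n y) : x = y :=
  (bicomplex E).total_ext n h

theorem exists_totalComplex (E : LambdaCat p ⥤ ModuleCat.{u} k) (n : ℕ)
    (y : ∀ _ j : ℕ, E.obj (LambdaCat.ob p j)) :
    ∃ x : ((totalComplex k p).obj E).X n, ∀ i j, i + j = n → totalπ E i j n x = y i j :=
  (bicomplex E).exists_total n y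

theorem totalπ_map {E F : LambdaCat p ⥤ ModuleCat.{u} k} (f : E ⟶ F) (i j n : ℕ)
    (x : ((totalComplex k p).obj E).X n) :
    totalπ F i j n (((totalComplex k p).map f).f n x) =
      f.app (LambdaCat.ob p j) (totalπ E i j n x) :=
  (bicomplex E).πTotal_map_apply (bicomplexMap f) i j n x

instance : (totalComplex k p).PreservesZeroMorphisms where
  map_zero E F := by
    ext n x
    refine totalComplex_ext F n fun i j _ => ?_
    refine (totalπ_map (0 : E ⟶ F) i j n x).trans ?_
    exact (map_zero (totalπ F i j n).hom).symm

/-- Exactness of functors is pointwise, and each degree of the total complex is a finite product of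
values, on which a natural transformation acts coordinatewise. -/
theorem totalComplex_shortExact (S : ShortComplex (LambdaCat p ⥤ ModuleCat.{u} k))
    (hS : S.ShortExact) : (S.map (totalComplex k p)).ShortExact := by
  have hd (c : LambdaCat p) : (S.map ((evaluation _ _).obj c)).ShortExact := hS.map_of_exact _
  have hinj (c : LambdaCat p) : Function.Injective (S.f.app c) :=
    (ModuleCat.mono_iff_injective (S.f.app c)).1 (hd c).mono_f
  have hsurj (c : LambdaCat p) : Function.Surjective (S.g.app c) :=
    (ModuleCat.epi_iff_surjective (S.g.app c)).1 (hd c).epi_g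
  have hex (c : LambdaCat p) (x : S.X₂.obj c) (hx : S.g.app c x = 0) : ∃ y, S.f.app c y = x :=
    (ShortComplex.moduleCat_exact_iff _).1 (hd c).exact x hx
  refine HomologicalComplex.shortExact_of_degreewise_shortExact _ fun n => ?_
  refine { exact := ?_, mono_f := ?_, epi_g := ?_ }
  · rw [ShortComplex.moduleCat_exact_iff]
    intro x hx
    have h (j : ℕ) (i : ℕ) (hij : i + j = n) :
        ∃ y, S.f.app (LambdaCat.ob p j) y = totalπ S.X₂ i j n x := by
      refine hex _ _ ?_
      refine (totalπ_map S.g i j n x).symm.trans ?_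
      exact (congrArg (totalπ S.X₃ i j n).hom hx).trans (map_zero _)
    choose! y hy using h
    obtain ⟨z, hz⟩ := exists_totalComplex S.X₁ n fun i j => y j i
    refine ⟨z, totalComplex_ext S.X₂ n fun i j hij => ?_⟩
    refine (totalπ_map S.f i j n z).trans ?_
    rw [hz i j hij, hy j i hij]
  · refine (ModuleCat.mono_iff_injective _).2 ?_
    intro x y hxy
    refine totalComplex_ext S.X₁ n fun i j _ => hinj _ ?_
    refine (totalπ_map S.f i j n x).symm.trans (Eq.trans ?_ (totalπ_map S.f i j n y))
    exact congrArg (totalπ S.X₂ i j n).hom hxy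
  · refine (ModuleCat.epi_iff_surjective _).2 ?_
    intro x
    choose y hy using fun (i j : ℕ) => hsurj (LambdaCat.ob p j) (totalπ S.X₃ i j n x)
    obtain ⟨z, hz⟩ := exists_totalComplex S.X₂ n y
    refine ⟨z, totalComplex_ext S.X₃ n fun i j hij => ?_⟩
    refine (totalπ_map S.g i j n z).trans ?_
    rw [hz i j hij, hy i j]

/-- The operator `τ` on `E([n + 1])`, twisted by the sign `(-1)^n`, as a linear map. -/
def tLinear (E : LambdaCat p ⥤ ModuleCat.{u} k) (n : ℕ) :
    Module.End k (E.obj (LambdaCat.ob p n)) :=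
  ModuleCat.Hom.hom (t E n)

/-- The differential `b : E([n + 2]) ⟶ E([n + 1])` as a linear map. -/
def bLinear (E : LambdaCat p ⥤ ModuleCat.{u} k) (n : ℕ) :
    E.obj (LambdaCat.ob p (n + 1)) →ₗ[k] E.obj (LambdaCat.ob p n) :=
  ModuleCat.Hom.hom (b E n)

/-- The operator `id + τ + ⋯ + τ^(p(n + 1) - 1)` on `E([n + 1])` as a linear map. -/
def normLinear (E : LambdaCat p ⥤ ModuleCat.{u} k) (n : ℕ) :
    Module.End k (E.obj (LambdaCat.ob p n)) :=
  ∑ j ∈ Finset.range (p * (n + 1)), tLinear E n ^ j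

theorem tLinear_pow (E : LambdaCat p ⥤ ModuleCat.{u} k) (n j : ℕ) :
    ModuleCat.Hom.hom (t E n ^ j : End (E.obj (LambdaCat.ob p n))) = tLinear E n ^ j := by
  induction j with
  | zero => rfl
  | succ j ih =>
    rw [pow_succ, pow_succ, ← ih]
    rfl

theorem norm_hom (E : LambdaCat p ⥤ ModuleCat.{u} k) (n : ℕ) :
    ModuleCat.Hom.hom (norm E n) = normLinear E n := by
  refine (ModuleCat.hom_sum (M := E.obj (LambdaCat.ob p n)) (N := E.obj (LambdaCat.ob p n))
    (fun j => (t E n ^ j : End (E.obj (LambdaCat.ob p n)))) _).trans ?_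
  exact Finset.sum_congr rfl fun j _ => tLinear_pow E n j

/-- A criterion for the total complex of a `p`-cyclic vector space to be acyclic in positive
degrees. -/
theorem isZero_totalComplex_homology (E : LambdaCat p ⥤ ModuleCat.{u} k)
    (hsub : ∀ j x, x - tLinear E j x = 0 → ∃ y, normLinear E j y = x)
    (hnorm : ∀ j x, normLinear E j x = 0 → ∃ y, y - tLinear E j y = x)
    (hcol : ∀ j x w, bLinear E j x = w - tLinear E j w →
      ∃ y z, x = bLinear E (j + 1) y + (z - tLinear E (j + 1) z)) (n : ℕ) :
    IsZero (((totalComplex k p).obj E).homology (n + 1)) := by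
  have hd (i j : ℕ) : ((bicomplex E).d (i + 1) i).f j =
      if Even i then oneSubT E j else norm E j := by
    dsimp only [bicomplex]
    rw [ChainComplex.of_d]
    rfl
  have hv (j : ℕ) : ((bicomplex E).X 0).d (j + 1) j = b E j := by
    change (column E 0).d (j + 1) j = b E j
    dsimp only [column]
    rw [ChainComplex.of_d]
    rfl
  rw [← HomologicalComplex.exactAt_iff_isZero_homology,
    HomologicalComplex.exactAt_iff' _ (n + 2) (n + 1) n (by simp) (by simp),
    ShortComplex.moduleCat_exact_iff]
  refine (bicomplex E).total_exact ?_ ?_ n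
  -- The rows alternate between `id - τ` and the norm, so the parity of the column decides which of
  -- the two exactness hypotheses applies.
  · intro i j x hx
    rw [hd] at hx ⊢
    by_cases hi : Even i
    · rw [if_pos hi] at hx
      rw [if_neg (by simpa [Nat.even_add_one] using hi)]
      obtain ⟨y, hy⟩ := hsub j x hx
      exact ⟨y, (LinearMap.congr_fun (norm_hom E j) y).trans hy⟩
    · rw [if_neg hi] at hx
      rw [if_pos (by simpa [Nat.even_add_one] using hi)]
      exact hnorm j x ((LinearMap.congr_fun (norm_hom E j) x).symm.trans hx)
  · intro j x w h
    rw [hv, hd, if_pos (by simp)] at h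
    rw [hv, hd, if_pos (by simp)]
    exact hcol j x w h

end PCyclic

/-! ### The extra degeneracy on maps fixing zero, and offsets of morphisms of `Λ_p`. -/

namespace ParacyclicHom

/-- The redundant endpoint `a = m` is included because `⌈a / m⌉ = 1` exactly on the range `1 ≤ a ≤
m`. -/
theorem ext_of_pos {m n : ℕ} (hm : 1 ≤ m) {f g : ParacyclicHom m n}
    (h0 : f.toFun 0 = g.toFun 0) (h : ∀ a : ℤ, 1 ≤ a → a ≤ m → f.toFun a = g.toFun a) : f = g := by
  obtain ⟨m, rfl⟩ : ∃ m', m = m' + 1 := ⟨m - 1, by lia⟩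
  refine LambdaCat.hom_ext_period f g fun b hb hb' => ?_
  rcases hb.eq_or_lt with rfl | hb
  · exact h0
  · exact h b hb (by push_cast; lia)

theorem le_of_le {m n : ℕ} (f : ParacyclicHom m n) (h0 : f.toFun 0 = 0) {a : ℤ} (ha : a ≤ m) :
    f.toFun a ≤ n := by
  have h := f.map_add_period' 0
  rw [h0] at h
  have := f.monotone' ha
  rw [zero_add, zero_add] at h
  rwa [h] at this

/-- The map `a ↦ f(a) - f(0) + ⌈a / m⌉`. -/
def stretch {m n : ℕ} (hm : 1 ≤ m) (f : ParacyclicHom m n) : ParacyclicHom m (n + 1) where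
  toFun a := f.toFun a - f.toFun 0 + (a + (m - 1)) / m
  monotone' a b hab := by
    have h1 := f.monotone' hab
    have h2 : (a + ((m : ℤ) - 1)) / m ≤ (b + (m - 1)) / m :=
      Int.ediv_le_ediv (by positivity) (by lia)
    dsimp only
    lia
  map_add_period' a := by
    rw [f.map_add_period', add_right_comm, Int.add_ediv_of_dvd_right (dvd_refl _),
      Int.ediv_self (by positivity)]
    push_cast
    ring

theorem stretch_zero {m n : ℕ} (hm : 1 ≤ m) (f : ParacyclicHom m n) :
    (f.stretch hm).toFun 0 = 0 := by
  simp only [stretch]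
  rw [Int.ediv_eq_zero_of_lt (by lia) (by lia)]
  ring

theorem stretch_apply {m n : ℕ} (hm : 1 ≤ m) (f : ParacyclicHom m n) (a : ℤ) (ha : 1 ≤ a)
    (ha' : a ≤ m) : (f.stretch hm).toFun a = f.toFun a - f.toFun 0 + 1 := by
  have h : (a + ((m : ℤ) - 1)) / m = 1 := by
    rw [show a + ((m : ℤ) - 1) = a - 1 + m by ring, Int.add_ediv_of_dvd_right (dvd_refl _),
      Int.ediv_self (by positivity), Int.ediv_eq_zero_of_lt (by lia) (by lia), zero_add]
  simp only [stretch, h]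

theorem face_comp_zero {m n i : ℕ} (hi : i ≤ n) (f : ParacyclicHom m (n + 1))
    (h0 : f.toFun 0 = 0) : ((face n i).comp f).toFun 0 = 0 := by
  simp only [comp, h0]
  rw [LambdaCat.face_apply_zero _ _ hi _ le_rfl (by lia), if_pos (by lia)]

theorem face_comp_apply {m n i : ℕ} (hi : i ≤ n) (f : ParacyclicHom m (n + 1))
    (h0 : f.toFun 0 = 0) (a : ℤ) (ha : 0 ≤ a) (ha' : a ≤ m) :
    ((face n i).comp f).toFun a = if f.toFun a ≤ i then f.toFun a else f.toFun a - 1 := by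
  have h1 := f.monotone' ha
  have h2 := f.le_of_le h0 ha'
  rw [h0] at h1
  push_cast at h2
  simp only [comp]
  rw [LambdaCat.face_apply_zero _ _ hi _ h1 h2]

/-- On `1 ≤ a ≤ m`, `stretch` raises the values of `f` by one while keeping `0` fixed, and `m_0`
lowers all positive values back. With `face_succ_comp_stretch`, these are the identities of an extra
degeneracy. -/
theorem face_zero_comp_stretch {m n : ℕ} (hm : 1 ≤ m) (f : ParacyclicHom m n)
    (h0 : f.toFun 0 = 0) : (face n 0).comp (f.stretch hm) = f := by
  refine ext_of_pos hm ?_ fun a ha ha' => ?_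
  · rw [face_comp_zero (by lia) _ (f.stretch_zero hm), h0]
  · have h := f.monotone' (show 0 ≤ a by lia)
    rw [face_comp_apply (by lia) _ (f.stretch_zero hm) a (by lia) ha', stretch_apply hm f a ha ha',
      h0, if_neg (by push_cast; lia)]
    lia

theorem face_succ_comp_stretch {m n i : ℕ} (hm : 1 ≤ m) (f : ParacyclicHom m (n + 1))
    (h0 : f.toFun 0 = 0) (hi : i ≤ n) :
    (face (n + 1) (i + 1)).comp (f.stretch hm) = ((face n i).comp f).stretch hm := by
  refine ext_of_pos hm ?_ fun a ha ha' => ?_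
  · rw [face_comp_zero (by lia) _ (f.stretch_zero hm), stretch_zero]
  · rw [face_comp_apply (by lia) _ (f.stretch_zero hm) a (by lia) ha', stretch_apply hm f a ha ha',
      stretch_apply hm _ a ha ha', face_comp_zero (by lia) _ h0,
      face_comp_apply (by lia) _ h0 a (by lia) ha', h0]
    push_cast
    split_ifs <;> lia

end ParacyclicHom

namespace LambdaCat

variable {p : ℕ}

/-- The class of `f(0)` modulo `p(n + 1)`, for the class in `Λ_p` of a map `f`. -/
def offset {c : LambdaCat p} {n : ℕ} (φ : c ⟶ ob p n) : ZMod (p * (n + 1)) :=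
  Quotient.lift (fun f : ParacyclicHom c.size (n + 1) => (f.toFun 0 : ZMod (p * (n + 1)))) (by
    rintro f _ ⟨j, rfl⟩
    have h : (((p * (n + 1) : ℕ) : ℤ) : ZMod (p * (n + 1))) = 0 := by
      rw [Int.cast_natCast, ZMod.natCast_self]
    change (f.toFun 0 : ZMod (p * (n + 1))) = ((f.toFun 0 + j * p * (n + 1 : ℕ) : ℤ) : ZMod _)
    rw [Int.cast_add, show j * p * ((n + 1 : ℕ) : ℤ) = j * ((p * (n + 1) : ℕ) : ℤ) by
      push_cast; ring, Int.cast_mul, h, mul_zero, add_zero]) φ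

/-- The class in `Λ_p` of the map `a ↦ f(a) - f(0) + ⌈a / m⌉`, for the class of a map `f`. -/
def stretch {c : LambdaCat p} {n : ℕ} (φ : c ⟶ ob p n) : c ⟶ ob p (n + 1) :=
  Quotient.lift (fun f : ParacyclicHom c.size (n + 1) =>
    (homMk (f.stretch c.size_pos) : c ⟶ ob p (n + 1))) (by
    rintro f _ ⟨j, rfl⟩
    refine congrArg homMk ?_
    ext a
    simp only [ParacyclicHom.stretch, ParacyclicHom.comp, ParacyclicHom.sigma]
    ring) φ

theorem offset_homMk {c : LambdaCat p} {n : ℕ} (f : ParacyclicHom c.size (n + 1)) :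
    offset (homMk f : c ⟶ ob p n) = (f.toFun 0 : ZMod (p * (n + 1))) := rfl

theorem stretch_homMk {c : LambdaCat p} {n : ℕ} (f : ParacyclicHom c.size (n + 1)) :
    stretch (homMk f : c ⟶ ob p n) = homMk (f.stretch c.size_pos) := rfl

theorem homMk_comp_face {c : LambdaCat p} {n i : ℕ} (f : ParacyclicHom c.size (n + 2)) :
    (homMk f : c ⟶ ob p (n + 1)) ≫ face p n i = homMk ((ParacyclicHom.face (n + 1) i).comp f) := rfl

theorem exists_homMk {c : LambdaCat p} {n : ℕ} (φ : c ⟶ ob p n) :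
    ∃ f : ParacyclicHom c.size (n + 1), φ = homMk f := by
  induction φ using Quotient.inductionOn with
  | h f => exact ⟨f, rfl⟩

/-- Composing with `σ^p` shifts `f(0)` by `p(n + 1)`, so a representative whose value at `0` is a
multiple of `p(n + 1)` can be normalized. -/
theorem exists_homMk_of_offset_eq_zero {c : LambdaCat p} {n : ℕ} (φ : c ⟶ ob p n)
    (h : offset φ = 0) : ∃ f : ParacyclicHom c.size (n + 1), φ = homMk f ∧ f.toFun 0 = 0 := by
  obtain ⟨f, rfl⟩ := exists_homMk φ
  rw [offset_homMk, ZMod.intCast_zmod_eq_zero_iff_dvd] at h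
  obtain ⟨j, hj⟩ := h
  refine ⟨(ParacyclicHom.sigma (n + 1) (-j * p)).comp f, homMk_eq_of (-j) fun a => rfl, ?_⟩
  simp only [ParacyclicHom.comp, ParacyclicHom.sigma, hj]
  push_cast
  ring

/-- This makes the action of the cyclic group of order `p(n + 1)` on `Λ_p(c, [n+1])` free, with the
offset-zero morphisms as orbit representatives. -/
theorem offset_comp_tau_pow {c : LambdaCat p} {n : ℕ} (φ : c ⟶ ob p n) (j : ℕ) :
    offset (φ ≫ (tau p n ^ j : End (ob p n))) = offset φ + j := by
  obtain ⟨f, rfl⟩ := exists_homMk φ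
  rw [tau_pow]
  refine (offset_homMk ((ParacyclicHom.rot (n + 1) j).comp f)).trans ?_
  rw [offset_homMk]
  simp [ParacyclicHom.comp, ParacyclicHom.rot]

theorem offset_comp_face {c : LambdaCat p} {n i : ℕ} (φ : c ⟶ ob p (n + 1)) (h : offset φ = 0)
    (hi : i ≤ n + 1) : offset (φ ≫ face p n i) = 0 := by
  obtain ⟨f, rfl, hf⟩ := exists_homMk_of_offset_eq_zero φ h
  rw [homMk_comp_face, offset_homMk, ParacyclicHom.face_comp_zero hi f hf, Int.cast_zero]

theorem stretch_comp_face_zero {c : LambdaCat p} {n : ℕ} (φ : c ⟶ ob p n) (h : offset φ = 0) :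
    stretch φ ≫ face p n 0 = φ := by
  obtain ⟨f, rfl, hf⟩ := exists_homMk_of_offset_eq_zero φ h
  rw [stretch_homMk, homMk_comp_face, ParacyclicHom.face_zero_comp_stretch c.size_pos f hf]

theorem stretch_comp_face_succ {c : LambdaCat p} {n i : ℕ} (φ : c ⟶ ob p (n + 1))
    (h : offset φ = 0) (hi : i ≤ n + 1) :
    stretch φ ≫ face p (n + 1) (i + 1) = stretch (φ ≫ face p n i) := by
  obtain ⟨f, rfl, hf⟩ := exists_homMk_of_offset_eq_zero φ h
  rw [stretch_homMk, homMk_comp_face, homMk_comp_face, stretch_homMk,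
    ParacyclicHom.face_succ_comp_stretch c.size_pos f hf hi]

end LambdaCat

/-! ### Acyclicity when the values are induced modules with a contracted complex of representatives.
-/

namespace PCyclic

variable {k : Type u} [Field k] {p : ℕ}

section

variable (E : LambdaCat p ⥤ ModuleCat.{u} k)

theorem tLinear_pow_apply (n j : ℕ) (x : E.obj (LambdaCat.ob p n)) :
    (tLinear E n ^ j) x =
      (-1 : ℤ) ^ (n * j) • E.map (LambdaCat.tau p n ^ j : End (LambdaCat.ob p n)) x :=
  LinearMap.congr_fun ((tLinear_pow E n j).symm.trans (congrArg ModuleCat.Hom.hom (t_pow E n j))) x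

theorem tLinear_pow_mul (n : ℕ) : tLinear E n ^ (p * (n + 1)) = 1 :=
  (tLinear_pow E n _).symm.trans (congrArg ModuleCat.Hom.hom (t_pow_mul E n))

theorem bLinear_apply (n : ℕ) (x : E.obj (LambdaCat.ob p (n + 1))) :
    bLinear E n x = ∑ i ∈ Finset.range (n + 2), (-1 : ℤ) ^ i • E.map (LambdaCat.face p n i) x := by
  have h := ModuleCat.hom_sum (fun i => (-1 : ℤ) ^ i • E.map (LambdaCat.face p n i))
    (Finset.range (n + 2))
  exact (LinearMap.congr_fun h x).trans (LinearMap.sum_apply _ _ _)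

theorem bLinear_sub_tLinear (n : ℕ) (x : E.obj (LambdaCat.ob p (n + 1))) :
    ∃ z, bLinear E n (x - tLinear E (n + 1) x) = z - tLinear E n z :=
  ⟨b' E n x, LinearMap.congr_fun (congrArg ModuleCat.Hom.hom (oneSubT_comp_b E n)) x⟩

theorem exists_tLinear_pow_apply (n j : ℕ) (x : E.obj (LambdaCat.ob p n)) :
    ∃ z, (tLinear E n ^ j) x = x + (z - tLinear E n z) := by
  induction j with
  | zero => exact ⟨0, by simp⟩
  | succ j ih =>
    obtain ⟨z, hz⟩ := ih
    refine ⟨z - (tLinear E n ^ j) x, ?_⟩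
    rw [pow_succ', Module.End.mul_apply, map_sub]
    rw [← sub_eq_iff_eq_add'] at hz
    rw [← sub_eq_iff_eq_add']
    rw [sub_sub_sub_comm, ← hz]
    abel

theorem normLinear_tLinear (n : ℕ) (x : E.obj (LambdaCat.ob p n)) :
    normLinear E n (tLinear E n x) = normLinear E n x := by
  rw [← sub_eq_zero, ← map_sub, ← neg_eq_zero, ← map_neg, neg_sub]
  have h := geom_sum_mul_neg (tLinear E n) (p * (n + 1))
  rw [tLinear_pow_mul, sub_self] at h
  exact LinearMap.congr_fun h x

variable (e : ∀ n, Module.End k (E.obj (LambdaCat.ob p n)))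
  (h : ∀ n, E.obj (LambdaCat.ob p n) →ₗ[k] E.obj (LambdaCat.ob p (n + 1)))
  (hsum : ∀ n, ∑ i ∈ Finset.range (p * (n + 1)),
    tLinear E n ^ i * e n * tLinear E n ^ (p * (n + 1) - i) = 1)

-- Modulo the image of `id - τ`, every power of `τ` acts as the identity. Dropping the outer factors
-- `τ^i` from the decomposition `hsum` of `x` leaves `e` applied to the norm of `x`.
include hsum in
theorem exists_projection_norm (n : ℕ) (x : E.obj (LambdaCat.ob p n)) :
    ∃ z, x = e n (normLinear E n x) + (z - tLinear E n z) := by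
  choose z hz using fun i =>
    exists_tLinear_pow_apply E n i (e n ((tLinear E n ^ (p * (n + 1) - i)) x))
  refine ⟨∑ i ∈ Finset.range (p * (n + 1)), z i, ?_⟩
  have h1 : x = ∑ i ∈ Finset.range (p * (n + 1)),
      (tLinear E n ^ i) (e n ((tLinear E n ^ (p * (n + 1) - i)) x)) := by
    have := LinearMap.congr_fun (hsum n) x
    rw [LinearMap.sum_apply] at this
    exact this.symm
  -- The exponents `p(n + 1) - i` run from `1` to `p(n + 1)`, not from `0`; the shift is absorbed by
  -- the invariance of the norm under `τ`.
  have h2 : normLinear E n x =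
      ∑ i ∈ Finset.range (p * (n + 1)), (tLinear E n ^ (p * (n + 1) - i)) x := by
    rw [← normLinear_tLinear, normLinear, LinearMap.sum_apply,
      ← Finset.sum_range_reflect (fun i => (tLinear E n ^ i) (tLinear E n x))]
    refine Finset.sum_congr rfl fun i hi => ?_
    have := Finset.mem_range.1 hi
    rw [← Module.End.mul_apply, ← pow_succ,
      show p * (n + 1) - 1 - i + 1 = p * (n + 1) - i by lia]
  calc x = _ := h1
    _ = ∑ i ∈ Finset.range (p * (n + 1)), (e n ((tLinear E n ^ (p * (n + 1) - i)) x) +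
        (z i - tLinear E n (z i))) := Finset.sum_congr rfl fun i _ => hz i
    _ = _ := by rw [Finset.sum_add_distrib, Finset.sum_sub_distrib, h2, map_sum, map_sum]

variable (he : ∀ n, e n * e n = e n)
  (hnorm : ∀ n, e n * normLinear E n * e n = e n)
  (hb : ∀ n, e n ∘ₗ bLinear E n ∘ₗ e (n + 1) = bLinear E n ∘ₗ e (n + 1))
  (hh : ∀ n, bLinear E (n + 1) ∘ₗ h (n + 1) ∘ₗ e (n + 1) + h n ∘ₗ bLinear E n ∘ₗ e (n + 1) =
    e (n + 1))

include hsum he hnorm hb hh in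
/-- The total complex is acyclic in positive degrees if each `E([n + 1])` is induced, via the
projection `e`, from the trivial subgroup of the cyclic group of order `p(n + 1)`, and the images
of the projections `e` form a subcomplex for `b` contracted by `h`. -/
theorem isZero_totalComplex_homology_of_contraction (n : ℕ) :
    IsZero (((totalComplex k p).obj E).homology (n + 1)) := by
  refine isZero_totalComplex_homology E (fun n x hx => ?_) (fun n x hx => ?_)
    (fun n x w hx => ?_) n
  -- For `x` invariant under `τ`, `hsum` reads: the norm of `e x` is `x`.
  · have hpow (j : ℕ) : (tLinear E n ^ j) x = x := by
      induction j with
      | zero => rfl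
      | succ j ih => rw [pow_succ, Module.End.mul_apply, ← sub_eq_zero.1 hx, ih]
    refine ⟨e n x, ?_⟩
    have := LinearMap.congr_fun (hsum n) x
    rw [LinearMap.sum_apply] at this
    rw [normLinear, LinearMap.sum_apply]
    refine Eq.trans (Finset.sum_congr rfl fun i _ => ?_) this
    rw [Module.End.mul_apply, Module.End.mul_apply, hpow]
  · obtain ⟨z, hz⟩ := exists_projection_norm E e hsum n x
    exact ⟨z, by rw [hx, map_zero, zero_add] at hz; exact hz.symm⟩
  · obtain ⟨z, hz⟩ := exists_projection_norm E e hsum (n + 1) x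
    -- Modulo `id - τ`, the element `x` may be replaced by its representative `y` in the image of
    -- `e`. Then `b y` is in the image of `id - τ`, hence killed by the norm, and in the image of
    -- `e`, on which `e` composed with the norm is the identity. So `b y = 0`, and the contraction
    -- gives `y = b (h y)`.
    obtain ⟨v, hv⟩ := bLinear_sub_tLinear E n z
    set y := e (n + 1) (normLinear E (n + 1) x) with hy
    have hey : e (n + 1) y = y := LinearMap.congr_fun (he (n + 1)) _
    have h1 : bLinear E n y = (w - v) - tLinear E n (w - v) := by
      rw [map_sub, sub_sub_sub_comm, ← hx, ← hv, ← map_sub]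
      congr 1
      exact eq_sub_of_add_eq hz.symm
    have h2 : e n (bLinear E n y) = bLinear E n y := by
      have := LinearMap.congr_fun (hb n) y
      simp only [LinearMap.comp_apply, hey] at this
      exact this
    have h3 : bLinear E n y = 0 := by
      have h4 := LinearMap.congr_fun (hnorm n) (bLinear E n y)
      simp only [Module.End.mul_apply] at h4
      rw [h2] at h4
      rw [← h4, h1, map_sub, normLinear_tLinear, sub_self, map_zero]
    have h5 := LinearMap.congr_fun (hh n) y
    simp only [LinearMap.add_apply, LinearMap.comp_apply, hey, h3, map_zero, add_zero] at h5
    exact ⟨h (n + 1) y, z, by rw [h5]; exact hz⟩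

end

/-! ### Acyclicity of sums of corepresentable functors and of projectives. -/

section FreeCover

variable (V : LambdaCat p → Type u)

variable (k) in
/-- The sum over the objects `c` of `Λ_p` and the elements of `V c` of the functors
`k[Λ_p(c, -)]`. -/
noncomputable def freeFunctor : LambdaCat p ⥤ ModuleCat.{u} k where
  obj d := ModuleCat.of k ((Σ c, V c × (c ⟶ d)) →₀ k)
  map f := ModuleCat.ofHom (Finsupp.lmapDomain k k fun s => ⟨s.1, s.2.1, s.2.2 ≫ f⟩)
  map_id d := by
    ext1
    refine Finsupp.lhom_ext fun s a => ?_
    simp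
  map_comp f g := by
    ext1
    refine Finsupp.lhom_ext fun s a => ?_
    simp

variable {V}

/-- The generators of `freeFunctor k V`. -/
noncomputable def freeSingle {d : LambdaCat p} (s : Σ c, V c × (c ⟶ d)) (a : k) :
    (freeFunctor k V).obj d :=
  (Finsupp.single s a : (Σ c, V c × (c ⟶ d)) →₀ k)

theorem freeFunctor_hom_ext {d : LambdaCat p} {N : Type*} [AddCommGroup N] [Module k N]
    {f g : (freeFunctor k V).obj d →ₗ[k] N}
    (h : ∀ s a, f (freeSingle s a) = g (freeSingle s a)) : f = g :=
  Finsupp.lhom_ext h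

theorem freeFunctor_map_single {d d' : LambdaCat p} (f : d ⟶ d') (s : Σ c, V c × (c ⟶ d)) (a : k) :
    (freeFunctor k V).map f (freeSingle s a) = freeSingle ⟨s.1, s.2.1, s.2.2 ≫ f⟩ a :=
  Finsupp.mapDomain_single

variable (V) in
/-- The projection of `freeFunctor k V` to the span of the generators with zero offset. -/
noncomputable def offsetProjection (n : ℕ) :
    Module.End k ((freeFunctor k V).obj (LambdaCat.ob p n)) :=
  Finsupp.lsum k fun s : Σ c, V c × (c ⟶ LambdaCat.ob p n) =>
    if LambdaCat.offset s.2.2 = 0 then Finsupp.lsingle s else 0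

theorem offsetProjection_single (n : ℕ) (s : Σ c, V c × (c ⟶ LambdaCat.ob p n)) (a : k) :
    offsetProjection V n (freeSingle s a) =
      if LambdaCat.offset s.2.2 = 0 then freeSingle s a else 0 := by
  have h (P : Prop) [Decidable P] : (if P then Finsupp.lsingle s else 0 :
      k →ₗ[k] (Σ c, V c × (c ⟶ LambdaCat.ob p n)) →₀ k) a =
        if P then Finsupp.single s a else 0 := by
    split_ifs <;> rfl
  exact (Finsupp.lsum_single (R := k) k _ s a).trans (h _)

variable (k V) in
/-- The map of free modules induced by `LambdaCat.stretch`. -/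
noncomputable def stretchLinear (n : ℕ) : (freeFunctor k V).obj (LambdaCat.ob p n) →ₗ[k]
    (freeFunctor k V).obj (LambdaCat.ob p (n + 1)) :=
  Finsupp.lmapDomain k k fun s : Σ c, V c × (c ⟶ LambdaCat.ob p n) =>
    (⟨s.1, s.2.1, LambdaCat.stretch s.2.2⟩ : Σ c, V c × (c ⟶ LambdaCat.ob p (n + 1)))

theorem stretchLinear_single (n : ℕ) (s : Σ c, V c × (c ⟶ LambdaCat.ob p n)) (a : k) :
    stretchLinear k V n (freeSingle s a) =
      freeSingle ⟨s.1, s.2.1, LambdaCat.stretch s.2.2⟩ a :=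
  Finsupp.mapDomain_single

theorem tLinear_pow_single (n j : ℕ) (s : Σ c, V c × (c ⟶ LambdaCat.ob p n)) (a : k) :
    (tLinear (freeFunctor k V) n ^ j) (freeSingle s a) = (-1 : ℤ) ^ (n * j) •
      freeSingle ⟨s.1, s.2.1, s.2.2 ≫ (LambdaCat.tau p n ^ j : End (LambdaCat.ob p n))⟩ a := by
  rw [tLinear_pow_apply, freeFunctor_map_single]

theorem bLinear_single (n : ℕ) (s : Σ c, V c × (c ⟶ LambdaCat.ob p (n + 1))) (a : k) :
    bLinear (freeFunctor k V) n (freeSingle s a) = ∑ i ∈ Finset.range (n + 2), (-1 : ℤ) ^ i •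
      freeSingle ⟨s.1, s.2.1, s.2.2 ≫ LambdaCat.face p n i⟩ a := by
  rw [bLinear_apply]
  exact Finset.sum_congr rfl fun i _ => by rw [freeFunctor_map_single]

theorem offsetProjection_mul_self (n : ℕ) :
    offsetProjection (k := k) V n * offsetProjection V n = offsetProjection V n := by
  refine freeFunctor_hom_ext fun s a => ?_
  rw [Module.End.mul_apply, offsetProjection_single]
  split_ifs with h
  · rw [offsetProjection_single, if_pos h]
  · rw [map_zero]

/-- On a generator of offset `o`, the power `τ^(p(n + 1) - i)` changes the offset to `o - i`, so
only the index `i = o` survives the projection; its term is `τ^(p(n + 1)) = id`, signs included. -/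
theorem sum_offsetProjection (hp : 1 ≤ p) (n : ℕ) :
    ∑ i ∈ Finset.range (p * (n + 1)), tLinear (freeFunctor k V) n ^ i * offsetProjection V n *
      tLinear (freeFunctor k V) n ^ (p * (n + 1) - i) = 1 := by
  have hN : NeZero (p * (n + 1)) := ⟨by positivity⟩
  refine freeFunctor_hom_ext fun s a => ?_
  rw [LinearMap.sum_apply, Finset.sum_eq_single (LambdaCat.offset s.2.2).val]
  · have hlt := ZMod.val_lt (LambdaCat.offset s.2.2)
    rw [Module.End.mul_apply, Module.End.mul_apply, tLinear_pow_single, map_zsmul,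
      offsetProjection_single, if_pos, ← tLinear_pow_single, ← Module.End.mul_apply, ← pow_add,
      Nat.add_sub_cancel' hlt.le, tLinear_pow_mul]
    dsimp only
    rw [LambdaCat.offset_comp_tau_pow, Nat.cast_sub hlt.le, ZMod.natCast_self, ZMod.natCast_zmod_val]
    ring
  · intro i hi hne
    have hlt := Finset.mem_range.1 hi
    rw [Module.End.mul_apply, Module.End.mul_apply, tLinear_pow_single, map_zsmul,
      offsetProjection_single, if_neg, smul_zero, map_zero]
    dsimp only
    rw [LambdaCat.offset_comp_tau_pow, Nat.cast_sub hlt.le, ZMod.natCast_self, zero_sub,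
      ← sub_eq_add_neg, sub_eq_zero]
    intro h
    rw [h, ZMod.val_natCast_of_lt hlt] at hne
    exact hne rfl
  · intro hi
    exact absurd (Finset.mem_range.2 (ZMod.val_lt _)) hi

/-- A generator of offset zero is moved by `τ^i` to offset `i`, nonzero for `0 < i < p(n + 1)`, so
only the term `i = 0` of the norm survives. -/
theorem offsetProjection_normLinear (hp : 1 ≤ p) (n : ℕ) :
    offsetProjection V n * normLinear (freeFunctor k V) n * offsetProjection V n =
      offsetProjection V n := by
  refine freeFunctor_hom_ext fun s a => ?_
  rw [Module.End.mul_apply, Module.End.mul_apply, offsetProjection_single]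
  split_ifs with h
  · rw [normLinear, LinearMap.sum_apply, map_sum, Finset.sum_eq_single 0]
    · rw [pow_zero, Module.End.one_apply, offsetProjection_single, if_pos h]
    · intro i hi hne
      rw [tLinear_pow_single, map_zsmul, offsetProjection_single, if_neg, smul_zero]
      dsimp only
      rw [LambdaCat.offset_comp_tau_pow, h, zero_add, ZMod.natCast_eq_zero_iff]
      exact Nat.not_dvd_of_pos_of_lt (by lia) (Finset.mem_range.1 hi)
    · intro h0
      exact absurd (Finset.mem_range.2 (by positivity)) h0
  · simp only [map_zero]

theorem offsetProjection_bLinear (n : ℕ) :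
    offsetProjection V n ∘ₗ bLinear (freeFunctor k V) n ∘ₗ offsetProjection V (n + 1) =
      bLinear (freeFunctor k V) n ∘ₗ offsetProjection V (n + 1) := by
  refine freeFunctor_hom_ext fun s a => ?_
  simp only [LinearMap.comp_apply]
  rw [offsetProjection_single]
  split_ifs with h
  · rw [bLinear_single, map_sum]
    refine Finset.sum_congr rfl fun i hi => ?_
    have hi' := Finset.mem_range.1 hi
    rw [map_zsmul, offsetProjection_single, if_pos (LambdaCat.offset_comp_face _ h (by lia))]
  · simp only [map_zero]

/-- In `b` of a stretched generator, the face `m_0` gives the generator back. The face `m_{i+1}`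
gives the stretch of the `i`-th face with the opposite sign, cancelling the second summand. -/
theorem stretchLinear_contraction (n : ℕ) :
    bLinear (freeFunctor k V) (n + 1) ∘ₗ stretchLinear k V (n + 1) ∘ₗ offsetProjection V (n + 1) +
      stretchLinear k V n ∘ₗ bLinear (freeFunctor k V) n ∘ₗ offsetProjection V (n + 1) =
    offsetProjection V (n + 1) := by
  refine freeFunctor_hom_ext fun s a => ?_
  simp only [LinearMap.add_apply, LinearMap.comp_apply]
  rw [offsetProjection_single]
  split_ifs with h
  · rw [stretchLinear_single, bLinear_single, bLinear_single, map_sum, Finset.sum_range_succ',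
      pow_zero, one_smul, add_right_comm, ← Finset.sum_add_distrib]
    dsimp only
    rw [LambdaCat.stretch_comp_face_zero _ h, Finset.sum_eq_zero, zero_add]
    intro i hi
    have hi' := Finset.mem_range.1 hi
    rw [LambdaCat.stretch_comp_face_succ _ h (by lia), map_zsmul, stretchLinear_single, pow_succ,
      mul_neg_one, neg_smul, neg_add_cancel]
  · simp only [map_zero, add_zero]

theorem isZero_totalComplex_homology_freeFunctor (hp : 1 ≤ p) (n : ℕ) :
    IsZero (((totalComplex k p).obj (freeFunctor k V)).homology (n + 1)) :=
  isZero_totalComplex_homology_of_contraction _ (offsetProjection V) (stretchLinear k V)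
    (sum_offsetProjection hp) offsetProjection_mul_self (offsetProjection_normLinear hp)
    offsetProjection_bLinear stretchLinear_contraction n

/-- The canonical epimorphism from a free functor to `E`. -/
noncomputable def freeCover (E : LambdaCat p ⥤ ModuleCat.{u} k) :
    freeFunctor k (fun c => E.obj c) ⟶ E where
  app d := ModuleCat.ofHom (Finsupp.linearCombination k fun s : Σ c, E.obj c × (c ⟶ d) =>
    E.map s.2.2 s.2.1)
  naturality d d' f := by
    ext1
    refine freeFunctor_hom_ext fun s a => ?_
    have h (c : LambdaCat p) (s : Σ c', E.obj c' × (c' ⟶ c)) : Finsupp.linearCombination k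
        (fun s : Σ c', E.obj c' × (c' ⟶ c) => E.map s.2.2 s.2.1) (freeSingle s a) =
          a • E.map s.2.2 s.2.1 := Finsupp.linearCombination_single _ _ _
    have h1 := freeFunctor_map_single f s a
    refine (congrArg _ h1).trans ((h d' _).trans ?_)
    refine Eq.trans ?_ (congrArg (E.map f) (h d s)).symm
    simp

instance (E : LambdaCat p ⥤ ModuleCat.{u} k) : Epi (freeCover E) := by
  rw [NatTrans.epi_iff_epi_app]
  intro d
  rw [ModuleCat.epi_iff_surjective]
  intro x
  refine ⟨freeSingle ⟨d, x, 𝟙 d⟩ 1, (Finsupp.linearCombination_single k _ _).trans ?_⟩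
  simp

/-- A projective is a retract of its free cover, so the identity of its homology factors through a
zero object. -/
theorem isZero_totalComplex_homology_of_projective (hp : 1 ≤ p)
    (E : LambdaCat p ⥤ ModuleCat.{u} k) (hE : Projective E) (n : ℕ) :
    IsZero (((totalComplex k p).obj E).homology (n + 1)) := by
  have h := isZero_totalComplex_homology_freeFunctor (k := k) (V := fun c => E.obj c) hp n
  let H := totalComplex k p ⋙ HomologicalComplex.homologyFunctor _ _ (n + 1)
  have h1 : H.map (Projective.factorThru (𝟙 E) (freeCover E)) ≫ H.map (freeCover E) = 𝟙 _ := by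
    rw [← H.map_comp, Projective.factorThru_comp, H.map_id]
  change IsZero (H.obj E)
  rw [IsZero.iff_id_eq_zero, ← h1]
  exact (congrArg (· ≫ H.map (freeCover E)) (h.eq_of_tgt _ 0)).trans zero_comp

end FreeCover

end PCyclic

/-! ### Degree zero: the total complex computes the direct limit. -/

section TotalComplex

variable {C : Type*} [Category* C] [Preadditive C]
  (K : HomologicalComplex₂ C (ComplexShape.down ℕ) (ComplexShape.down ℕ))
  [K.HasTotal (ComplexShape.down ℕ)]

namespace HomologicalComplex₂

theorem ι_one_zero_d :
    K.ιTotal (ComplexShape.down ℕ) 1 0 1 rfl ≫ (K.total (ComplexShape.down ℕ)).d 1 0 =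
      (K.d 1 0).f 0 ≫ K.ιTotal (ComplexShape.down ℕ) 0 0 0 rfl := by
  rw [total_d, Preadditive.comp_add, ι_D₁, ι_D₂, d₂_eq_zero _ _ _ _ _ (by simp), add_zero]
  exact (d₁_eq K _ (i₁ := 1) (i₁' := 0) rfl _ _ rfl).trans (one_smul _ _)

theorem ι_zero_one_d :
    K.ιTotal (ComplexShape.down ℕ) 0 1 1 rfl ≫ (K.total (ComplexShape.down ℕ)).d 1 0 =
      (K.X 0).d 1 0 ≫ K.ιTotal (ComplexShape.down ℕ) 0 0 0 rfl := by
  rw [total_d, Preadditive.comp_add, ι_D₁, ι_D₂, d₁_eq_zero _ _ _ _ _ (by simp), zero_add]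
  exact (d₂_eq K _ _ (i₂ := 1) (i₂' := 0) rfl _ rfl).trans (one_smul _ _)

theorem πTotal_zero_ι :
    K.πTotal 0 0 0 ≫ K.ιTotal (ComplexShape.down ℕ) 0 0 0 rfl = 𝟙 _ := by
  have h := K.sum_πTotal_ι 0
  rw [Finset.HasAntidiagonal.antidiagonal_zero, Finset.sum_singleton] at h
  exact (congrArg (K.πTotal 0 0 0 ≫ ·)
    (K.ιTotalOrZero_eq (ComplexShape.down ℕ) 0 0 0 rfl)).symm.trans h

end HomologicalComplex₂

end TotalComplex

namespace LambdaCat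

variable {p : ℕ}

/-- On one period the stretched map takes values `1` or `2` away from `0`, and `m_1` sends both to
`1`. The composite is always `a ↦ ⌈a / m⌉`, with `m` the size of `c`. -/
theorem stretch_comp_face_one {c : LambdaCat p} (φ ψ : c ⟶ ob p 0) (hφ : offset φ = 0)
    (hψ : offset ψ = 0) : stretch φ ≫ face p 0 1 = stretch ψ ≫ face p 0 1 := by
  obtain ⟨f, rfl, hf⟩ := exists_homMk_of_offset_eq_zero φ hφ
  obtain ⟨g, rfl, hg⟩ := exists_homMk_of_offset_eq_zero ψ hψ
  have key (f : ParacyclicHom c.size 1) (hf : f.toFun 0 = 0) (a : ℤ) (ha : 1 ≤ a)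
      (ha' : a ≤ c.size) :
      ((ParacyclicHom.face 1 1).comp (f.stretch c.size_pos)).toFun a = 1 := by
    have h1 := f.monotone' (show 0 ≤ a by lia)
    have h2 := f.le_of_le hf ha'
    rw [ParacyclicHom.face_comp_apply (by lia) _ (f.stretch_zero _) a (by lia) ha',
      ParacyclicHom.stretch_apply _ f a ha ha', hf]
    push_cast at h2 ⊢
    split_ifs <;> lia
  rw [stretch_homMk, stretch_homMk, homMk_comp_face, homMk_comp_face]
  refine congrArg homMk (ParacyclicHom.ext_of_pos c.size_pos ?_ fun a ha ha' => ?_)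
  · rw [ParacyclicHom.face_comp_zero (by lia) _ (f.stretch_zero _),
      ParacyclicHom.face_comp_zero (by lia) _ (g.stretch_zero _)]
  · rw [key f hf a ha ha', key g hg a ha ha']

/-- A morphism `[n] ⟶ [1]`. -/
def toObZero (c : LambdaCat p) : c ⟶ ob p 0 :=
  homMk (X := c) (Y := ob p 0)
    { toFun := fun a => a / c.size
      monotone' := fun _ _ h => Int.ediv_le_ediv (by exact_mod_cast c.size_pos) h
      map_add_period' := fun a => by
        have := c.size_pos
        rw [Int.add_ediv_of_dvd_right (dvd_refl _), Int.ediv_self (by positivity)]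
        rfl }

/-- A morphism out of `E([1])` that equalizes the rotation of `[1]` and the two maps `[2] ⟶ [1]`
coequalizes all pairs of morphisms with target `[1]`. -/
theorem map_comp_eq_of_coequalizes (hp : 1 ≤ p) {C : Type*} [Category* C] (E : LambdaCat p ⥤ C)
    {Z : C} (q : E.obj (ob p 0) ⟶ Z) (hτ : E.map (tau p 0) ≫ q = q)
    (hm : E.map (face p 0 0) ≫ q = E.map (face p 0 1) ≫ q) {c : LambdaCat p} (φ ψ : c ⟶ ob p 0) :
    E.map φ ≫ q = E.map ψ ≫ q := by
  have hN : NeZero (p * (0 + 1)) := ⟨by positivity⟩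
  have hpow (j : ℕ) : E.map (tau p 0 ^ j : End (ob p 0)) ≫ q = q := by
    induction j with
    | zero => rw [pow_zero, End.one_def, E.map_id, Category.id_comp]
    | succ j ih => rw [pow_succ, End.mul_def, E.map_comp, Category.assoc, ih, hτ]
  have hnormalize (φ : c ⟶ ob p 0) : ∃ φ', offset φ' = 0 ∧ E.map φ' ≫ q = E.map φ ≫ q := by
    refine ⟨φ ≫ (tau p 0 ^ (-offset φ).val : End (ob p 0)), ?_, ?_⟩
    · rw [offset_comp_tau_pow, ZMod.natCast_zmod_val, add_neg_cancel]
    · rw [E.map_comp, Category.assoc, hpow]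
  -- An offset-zero `φ` factors as its stretch followed by `m_0`; trading `m_0` for `m_1` yields a
  -- composite independent of `φ`.
  have hface (φ : c ⟶ ob p 0) (h : offset φ = 0) :
      E.map φ ≫ q = E.map (stretch φ ≫ face p 0 1) ≫ q := by
    rw [E.map_comp, Category.assoc, ← hm, ← Category.assoc, ← E.map_comp,
      stretch_comp_face_zero φ h]
  obtain ⟨φ', hφ, hφ'⟩ := hnormalize φ
  obtain ⟨ψ', hψ, hψ'⟩ := hnormalize ψ
  rw [← hφ', ← hψ', hface φ' hφ, hface ψ' hψ, stretch_comp_face_one φ' ψ' hφ hψ]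

end LambdaCat

namespace PCyclic

variable {k : Type u} [Field k] {p : ℕ}

section

variable (E : LambdaCat p ⥤ ModuleCat.{u} k)

/-- The identification of `E([1])` with the degree `0` part of the total complex. -/
noncomputable def totalι :
    E.obj (LambdaCat.ob p 0) ⟶ ((totalComplex k p).obj E).X 0 :=
  (bicomplex E).ιTotal (ComplexShape.down ℕ) 0 0 0 rfl

theorem totalπ_totalι : totalπ E 0 0 0 ≫ totalι E = 𝟙 _ :=
  (bicomplex E).πTotal_zero_ι

theorem totalι_totalπ : totalι E ≫ totalπ E 0 0 0 = 𝟙 _ :=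
  (bicomplex E).ι_πTotal 0 0 0 rfl

theorem totalπ_naturality {E F : LambdaCat p ⥤ ModuleCat.{u} k} (f : E ⟶ F) (i j n : ℕ) :
    ((totalComplex k p).map f).f n ≫ totalπ F i j n =
      totalπ E i j n ≫ f.app (LambdaCat.ob p j) :=
  HomologicalComplex₂.map_πTotal (bicomplexMap f) i j n

theorem oneSubT_zero : (oneSubT E 0 : E.obj (LambdaCat.ob p 0) ⟶ E.obj (LambdaCat.ob p 0)) =
    𝟙 _ - E.map (LambdaCat.tau p 0) := by
  have h : t E 0 = E.map (LambdaCat.tau p 0) := by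
    rw [t, pow_zero, one_smul]
  exact congrArg (fun s => 𝟙 (E.obj (LambdaCat.ob p 0)) - s) h

theorem b_zero : b E 0 = E.map (LambdaCat.face p 0 0) - E.map (LambdaCat.face p 0 1) := by
  simp [b, Finset.sum_range_succ, sub_eq_add_neg]

theorem exists_comp_d_eq_oneSub : ∃ w, w ≫ ((totalComplex k p).obj E).d 1 0 =
    (𝟙 _ - E.map (LambdaCat.tau p 0)) ≫ totalι E := by
  refine ⟨_, (bicomplex E).ι_one_zero_d.trans ?_⟩
  rw [← oneSubT_zero]
  rfl

theorem exists_comp_d_eq_face : ∃ w, w ≫ ((totalComplex k p).obj E).d 1 0 =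
    (E.map (LambdaCat.face p 0 0) - E.map (LambdaCat.face p 0 1)) ≫ totalι E := by
  refine ⟨_, (bicomplex E).ι_zero_one_d.trans ?_⟩
  rw [← b_zero]
  rfl

theorem d_totalπ : ∃ w v, ((totalComplex k p).obj E).d 1 0 ≫ totalπ E 0 0 0 =
    w ≫ (𝟙 _ - E.map (LambdaCat.tau p 0)) +
      v ≫ (E.map (LambdaCat.face p 0 0) - E.map (LambdaCat.face p 0 1)) := by
  refine ⟨totalπ E 1 0 1, totalπ E 0 1 1, ((bicomplex E).d_πTotal 0 0 0 rfl).trans ?_⟩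
  rw [← oneSubT_zero, ← b_zero, pow_zero, one_smul]
  rfl

/-- The canonical map from the degree zero opcycles of the total complex to the colimit. -/
noncomputable def opcyclesToColimit :
    ((totalComplex k p).obj E).opcycles 0 ⟶ colimit E :=
  HomologicalComplex.descOpcycles _ (totalπ E 0 0 0 ≫ colimit.ι E (LambdaCat.ob p 0)) 1
    (by simp) (by
      obtain ⟨w, v, h⟩ := d_totalπ E
      rw [← Category.assoc, h]
      simp [Preadditive.sub_comp, Preadditive.add_comp])

theorem p_opcyclesToColimit : HomologicalComplex.pOpcycles _ 0 ≫ opcyclesToColimit E =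
    totalπ E 0 0 0 ≫ colimit.ι E (LambdaCat.ob p 0) :=
  HomologicalComplex.p_descOpcycles _ _ _ _ _

/-- The canonical map from `E([1])` to the degree zero opcycles of the total complex. -/
noncomputable def toOpcycles :
    E.obj (LambdaCat.ob p 0) ⟶ ((totalComplex k p).obj E).opcycles 0 :=
  totalι E ≫ ((totalComplex k p).obj E).pOpcycles 0

/-- The two relations needed are the boundaries from the summands `(1, 0)` and `(0, 1)` of degree
one. -/
theorem map_toOpcycles (hp : 1 ≤ p) {c : LambdaCat p} (φ ψ : c ⟶ LambdaCat.ob p 0) :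
    E.map φ ≫ toOpcycles E = E.map ψ ≫ toOpcycles E := by
  refine LambdaCat.map_comp_eq_of_coequalizes hp E _ ?_ ?_ φ ψ
  · obtain ⟨w, hw⟩ := exists_comp_d_eq_oneSub E
    rw [eq_comm, ← sub_eq_zero]
    have h : (𝟙 _ - E.map (LambdaCat.tau p 0)) ≫ toOpcycles E = 0 := by
      rw [toOpcycles, ← Category.assoc, ← hw, Category.assoc, HomologicalComplex.d_pOpcycles,
        comp_zero]
    rwa [Preadditive.sub_comp, Category.id_comp] at h
  · obtain ⟨w, hw⟩ := exists_comp_d_eq_face E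
    rw [← sub_eq_zero, ← Preadditive.sub_comp, toOpcycles, ← Category.assoc, ← hw, Category.assoc,
      HomologicalComplex.d_pOpcycles, comp_zero]

/-- The inverse comes from the cocone sending `E(c)` to the quotient along any map `c ⟶ [1]`;
`map_toOpcycles` makes it independent of that map, which gives both compatibility and the inverse
identities. -/
theorem isIso_opcyclesToColimit (hp : 1 ≤ p) : IsIso (opcyclesToColimit E) := by
  let s : Cocone E :=
    { pt := ((totalComplex k p).obj E).opcycles 0
      ι :=
        { app := fun c => E.map c.toObZero ≫ toOpcycles E
          naturality := fun c d f => by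
            refine Eq.trans ?_ (Category.comp_id _).symm
            rw [← Category.assoc, ← E.map_comp]
            exact map_toOpcycles E hp _ _ } }
  have hs (c : LambdaCat p) : colimit.ι E c ≫ colimit.desc E s = E.map c.toObZero ≫ toOpcycles E :=
    colimit.ι_desc _ _
  refine ⟨colimit.desc E s, ?_, ?_⟩
  · rw [← cancel_epi (HomologicalComplex.pOpcycles _ 0)]
    refine (Category.assoc _ _ _).symm.trans ?_
    rw [p_opcyclesToColimit, Category.assoc, hs, map_toOpcycles E hp _ (𝟙 _), E.map_id,
      Category.id_comp, toOpcycles, ← Category.assoc, totalπ_totalι, Category.id_comp]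
    exact (Category.comp_id _).symm
  · refine colimit.hom_ext fun c => ?_
    refine (Category.assoc _ _ _).symm.trans ?_
    rw [hs, Category.assoc, toOpcycles, Category.assoc, p_opcyclesToColimit,
      ← Category.assoc (totalι E), totalι_totalπ, Category.id_comp, colimit.w]
    exact (Category.comp_id _).symm

theorem opcyclesToColimit_naturality {E F : LambdaCat p ⥤ ModuleCat.{u} k} (f : E ⟶ F) :
    HomologicalComplex.opcyclesMap ((totalComplex k p).map f) 0 ≫ opcyclesToColimit F =
      opcyclesToColimit E ≫ colim.map f := by
  rw [← cancel_epi (HomologicalComplex.pOpcycles _ 0), HomologicalComplex.p_opcyclesMap_assoc,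
    p_opcyclesToColimit, ← Category.assoc, totalπ_naturality, Category.assoc,
    reassoc_of% p_opcyclesToColimit E]
  exact congrArg (totalπ E 0 0 0 ≫ ·) (colimit.ι_map f (LambdaCat.ob p 0)).symm

end

variable (k) in
/-- The degree zero homology of the total complex is the direct limit. -/
noncomputable def totalHomologyZeroIso (hp : 1 ≤ p) :
    totalComplex k p ⋙ HomologicalComplex.homologyFunctor (ModuleCat.{u} k) _ 0 ≅
      (colim : (LambdaCat p ⥤ ModuleCat.{u} k) ⥤ ModuleCat.{u} k) :=
  NatIso.ofComponents (fun E => ((totalComplex k p).obj E).isoHomologyι₀ ≪≫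
    (have := isIso_opcyclesToColimit E hp
     asIso (opcyclesToColimit E))) fun {E F} f => by
    have h1 := HomologicalComplex.homologyι_naturality ((totalComplex k p).map f) 0
    have h2 := opcyclesToColimit_naturality f
    exact (Category.assoc _ _ _).symm.trans ((congrArg (· ≫ opcyclesToColimit F) h1).trans
      ((Category.assoc _ _ _).trans ((congrArg (HomologicalComplex.homologyι _ 0 ≫ ·) h2).trans
        (Category.assoc _ _ _).symm)))

end PCyclic

theorem mainTheorem10 {k : Type u} [Field k] (p : ℕ) (hp : 1 ≤ p) (n : ℕ) :
    Nonempty (smallCategoryHomology k (LambdaCat p) n ≅ PCyclic.totalHomology k p n) :=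
  nonempty_leftDerived_iso (PCyclic.totalComplex k p) PCyclic.totalComplex_shortExact
    (PCyclic.isZero_totalComplex_homology_of_projective hp) colim
    (PCyclic.totalHomologyZeroIso k hp) n
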